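/- Work over $\mathbb{C}$. A camera is a full-rank matrix $C\in\mathbb{C}^{3\times 4}$; its center is the point $c=\ker C\in\mathbb{P}^3$. For $c=(c_0:c_1:c_2:c_3)$ let $E(c)$ be the $6\times 4$ matrix with $$E(c)X=(c_1X_0-c_0X_1,\;c_2X_0-c_0X_2,\;c_3X_0-c_0X_3,\;c_2X_1-c_1X_2,\;c_3X_1-c_1X_3,\;c_3X_2-c_2X_3)^\top,$$ and put $\hat C=E(c)C^\dagger$, where $C^\dagger$ is any $4\times3$ matrix with $CC^\dagger=I$ (up to scaling, $\hat C$ does not depend on the choices). Let $\nu_d^N(X)$ be the vector of all monomials of degree $d$ in $X_0,\dots,X_N$, and for an $(h+1)\times(N+1)$ matrix $A$ let $\nu_d^{h,N}(A)$ be the matrix with $\nu_d^h(AX)=\nu_d^{h,N}(A)\,\nu_d^N(X)$. For $h=(h_0:h_1:h_2:h_3)\in(\mathbb{P}^3)^*$ let $$\hat H(h)=\begin{bmatrix} h_0&0&0&-h_2&-h_3&0\\ 0&h_0&0&h_1&0&-h_3\\ 0&0&h_0&0&h_1&h_2\end{bmatrix}.$$ Let $\mathbf{C}=(C_1,\dots,C_n)$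 be cameras and let $d\ge 2$. The degree-$d$ plane curve multiview variety $\mathcal{C}_{\mathbf{C},d}$ is the Zariski closure in $\big(\mathbb{P}^{\binom{d+2}{2}-1}\big)^n$ of the image of the rational map $$\Phi_{\mathbf{C},d}:(\mathbb{P}^3)^*\times\mathbb{P}^{\binom{d+2}{2}-1}\dashrightarrow\big(\mathbb{P}^{\binom{d+2}{2}-1}\big)^n,\qquad (h,\alpha)\mapsto\big(\nu_d^{5,2}(\hat C_i)^\top\,\nu_d^{2,5}(\hat H(h))^\top\alpha\big)_{i=1}^n .$$ Let $\omega^{\mathrm{tw}}$ be the coefficient vector of the Chow form $$-L_3^3-L_3^2L_2+2L_4L_3L_1-L_5L_1^2-L_4^2L_0+L_5L_3L_0+L_5L_2L_0$$ of the standard twisted cubic $(s^3:s^2t:st^2:t^3)$, where $L=(L_0:\dots:L_5)$ are the Plücker coordinates $[01],[02],[03],[12],[13],[23]$. For a $4\times 4$ matrix $M$ let $\wedge^2M$ be its $6\times 6$ matrix of $2\times 2$ minors, with rows and columns in the same order. Let $\Sigma$ be the $6\times 6$ matrix with antidiagonal $(1,-1,1,1,-1,1)$ and zeros elsewhere, and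 for $m\in\mathbb{P}^{12}$ let $$M(m)=\begin{bmatrix}0&m_0&m_1&m_2\\-m_0&0&m_3&m_4\\m_5&m_6&m_7&m_8\\m_9&m_{10}&m_{11}&m_{12}\end{bmatrix}.$$ The twisted cubic multiview variety $\mathcal{C}_{\mathbf{C}}^{\mathrm{tw}}$ is the Zariski closure in $(\mathbb{P}^9)^n$ of the image of the rational map $$\Psi_{\mathbf{C}}:\mathbb{P}^{12}\dashrightarrow(\mathbb{P}^9)^n,\qquad m\mapsto\big(\nu_3^{5,2}(\hat C_i)^\top\,\nu_3^{5,5}(\Sigma\,\wedge^2(M(m)^\top)\,\Sigma)^\top\omega^{\mathrm{tw}}\big)_{i=1}^n .$$ **Proposition.** The varieties $\mathcal{C}_{\mathbf{C},d}$ and $\mathcal{C}_{\mathbf{C}}^{\mathrm{tw}}$ are irreducible. If $\mathbf{C}$ contains at least two cameras with distinct centers, then $$\dim\mathcal{C}_{\mathbf{C},d}=\tfrac12d^2+\tfrac32d+3\quad\text{and}\quad\dim\mathcal{C}_{\mathbf{C}}^{\mathrm{tw}}=12 .$$ -/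

import Mathlib

namespace MultiviewCurves

noncomputable section

/-! ### Multiprojective space and its Zariski topology -/

/-- The product `(ℙ^N)^n` of `n` copies of the complex projective space whose homogeneous
coordinates are indexed by `ι`. (A separate name, so that no product topology interferes with the
Zariski topology below.) -/
def MultiProj (n : ℕ) (ι : Type) : Type := Fin n → Projectivization ℂ (ι → ℂ)

/-- A polynomial in the coordinates `x_{i,j}` (`i` the factor, `j` the coordinate in that factor)
is multihomogeneous of multidegree `D` if it is homogeneous of degree `D i` in the coordinates of
the `i`-th factor, for each `i`. -/
def IsMultihomogeneous {n : ℕ} {ι : Type} (F : MvPolynomial (Fin n × ι) ℂ) (D : Fin n → ℕ) :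
    Prop :=
  MvPolynomial.IsWeightedHomogeneous
    (fun x : Fin n × ι => (Pi.single x.1 1 : Fin n → ℕ)) F D

/-- The value of a polynomial at representatives of a point of `(ℙ^N)^n`. For a multihomogeneous
polynomial, whether it vanishes does not depend on the representatives. -/
def MultiProj.evalRep {n : ℕ} {ι : Type} (p : MultiProj n ι) (F : MvPolynomial (Fin n × ι) ℂ) : ℂ :=
  MvPolynomial.eval (fun x => (p x.1).rep x.2) F

/-- The Zariski topology on `(ℙ^N)^n`: the non-vanishing loci of multihomogeneous polynomials are
a basis of open sets. -/
instance MultiProj.zariskiTopology (n : ℕ) (ι : Type) : TopologicalSpace (MultiProj n ι) :=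
  TopologicalSpace.generateFrom
    {U | ∃ (D : Fin n → ℕ) (F : MvPolynomial (Fin n × ι) ℂ),
      IsMultihomogeneous F D ∧ U = {p | p.evalRep F ≠ 0}}

/-- The image of a rational map to `(ℙ^N)^n` that is given by the coordinate vectors
`f t 0, …, f t (n-1)` for `t` in the parameter set `S`; the map is defined at those `t` for which
none of these vectors is zero. -/
def ratImage {n : ℕ} {ι T : Type} (S : Set T) (f : T → Fin n → ι → ℂ) : Set (MultiProj n ι) :=
  {p | ∃ t ∈ S, ∃ h : ∀ i, f t i ≠ 0, p = fun i => Projectivization.mk ℂ (f t i) (h i)}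

/-! ### Veronese maps -/

/-- The exponent vectors of the monomials of degree `d` in `N + 1` variables. -/
abbrev Mon (N d : ℕ) : Type :=
  ↥(Finset.finsuppAntidiag (Finset.univ : Finset (Fin (N + 1))) d)

/-- The Veronese map `ν_d^N`: the vector of all monomials of degree `d`. -/
def veronese (N d : ℕ) (X : Fin (N + 1) → ℂ) : Mon N d → ℂ :=
  fun m => ∏ j, X j ^ m.1 j

/-- The matrix `ν_d^{h,N}(A)` that `A` induces on the vectors of monomials: the row of a monomial
`m` holds the coefficients of `m(AX)` as a polynomial in `X`. -/
def veroneseMat {h N : ℕ} (d : ℕ) (A : Matrix (Fin (h + 1)) (Fin (N + 1)) ℂ) :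
    Matrix (Mon h d) (Mon N d) ℂ :=
  Matrix.of fun m m' => MvPolynomial.coeff m'.1
    (∏ i, (∑ j, MvPolynomial.C (A i j) * MvPolynomial.X j) ^ m.1 i :
      MvPolynomial (Fin (N + 1)) ℂ)

/-- The defining relation `ν_d^h(AX) = ν_d^{h,N}(A) ν_d^N(X)`. -/
theorem veronese_mulVec {h N : ℕ} (d : ℕ) (A : Matrix (Fin (h + 1)) (Fin (N + 1)) ℂ)
    (X : Fin (N + 1) → ℂ) :
    veronese h d (A.mulVec X) = (veroneseMat d A).mulVec (veronese N d X) := by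
  funext m
  set P : MvPolynomial (Fin (N + 1)) ℂ :=
    ∏ i, (∑ j, MvPolynomial.C (A i j) * MvPolynomial.X j) ^ m.1 i with hP
  have hhom : P.IsHomogeneous d := by
    have h1 : ∑ i, 1 * m.1 i = d := by
      simpa using (Finset.mem_finsuppAntidiag.1 m.2).1
    rw [← h1]
    refine MvPolynomial.IsHomogeneous.prod _ _ _ fun i _ => MvPolynomial.IsHomogeneous.pow ?_ _
    exact MvPolynomial.IsHomogeneous.sum _ _ _ fun j _ => by
      simpa using (MvPolynomial.isHomogeneous_C (Fin (N + 1)) (A i j)).mul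
        (MvPolynomial.isHomogeneous_X ℂ j)
  have hsub : P.support ⊆ Finset.finsuppAntidiag Finset.univ d := by
    intro e he
    rw [Finset.mem_finsuppAntidiag]
    have := hhom (MvPolynomial.mem_support_iff.1 he)
    refine ⟨?_, Finset.subset_univ _⟩
    rw [← this, Finsupp.weight_apply, Finsupp.sum_fintype _ _ (by simp)]
    simp
  have he : MvPolynomial.eval X P = veronese h d (A.mulVec X) m := by
    simp [hP, veronese, Matrix.mulVec, dotProduct]
  rw [← he, MvPolynomial.eval_eq', Finset.sum_subset hsub, ← Finset.sum_coe_sort]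
  · rfl
  · intro e _ hne
    rw [MvPolynomial.notMem_support_iff.1 hne, zero_mul]

/-! ### Cameras -/

/-- A camera: a `3 × 4` complex matrix of full rank. -/
structure Camera where
  mat : Matrix (Fin 3) (Fin 4) ℂ
  rank_eq : mat.rank = 3

theorem Camera.exists_center (C : Camera) : ∃ c : Fin 4 → ℂ, c ≠ 0 ∧ C.mat.mulVec c = 0 := by
  have h : LinearMap.ker C.mat.mulVecLin ≠ ⊥ := LinearMap.ker_ne_bot_of_finrank_lt (by simp)
  obtain ⟨c, hc, h0⟩ := Submodule.exists_mem_ne_zero_of_ne_bot h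
  exact ⟨c, h0, by simpa using hc⟩

theorem Camera.exists_pinv (C : Camera) : ∃ D : Matrix (Fin 4) (Fin 3) ℂ, C.mat * D = 1 := by
  rw [← Matrix.mulVec_surjective_iff_exists_right_inverse]
  have h : LinearMap.range C.mat.mulVecLin = ⊤ :=
    Submodule.eq_top_of_finrank_eq (by simpa [Matrix.rank] using C.rank_eq)
  exact LinearMap.range_eq_top.1 h

/-- Homogeneous coordinates of the center of a camera, that is, a non-zero vector of its
(one-dimensional) kernel. -/
def Camera.center (C : Camera) : Fin 4 → ℂ := C.exists_center.choose

theorem Camera.center_ne_zero (C : Camera) : C.center ≠ 0 := C.exists_center.choose_spec.1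

theorem Camera.mulVec_center (C : Camera) : C.mat.mulVec C.center = 0 :=
  C.exists_center.choose_spec.2

/-- The center of a camera as a point of `ℙ^3`. -/
def Camera.centerPoint (C : Camera) : Projectivization ℂ (Fin 4 → ℂ) :=
  Projectivization.mk ℂ C.center C.center_ne_zero

/-- A pseudo-inverse `C†` of a camera matrix: `C C† = I`. -/
def Camera.pinv (C : Camera) : Matrix (Fin 4) (Fin 3) ℂ := C.exists_pinv.choose

theorem Camera.mul_pinv (C : Camera) : C.mat * C.pinv = 1 := C.exists_pinv.choose_spec

/-- The matrix `E(c)` of the join `X ↦ c ∨ X` in Plücker coordinates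
`[01], [02], [03], [12], [13], [23]`. -/
def joinMat (c : Fin 4 → ℂ) : Matrix (Fin 6) (Fin 4) ℂ :=
  !![c 1, -c 0, 0, 0;
     c 2, 0, -c 0, 0;
     c 3, 0, 0, -c 0;
     0, c 2, -c 1, 0;
     0, c 3, 0, -c 1;
     0, 0, c 3, -c 2]

/-- The matrix `Ĉ = E(c) C†` that sends an image point `x` to the Plücker coordinates of its
back-projected line. Up to a non-zero factor it depends neither on the choice of the vector `c`
nor on that of `C†`, since `E(c) c = 0`. -/
def Camera.hat (C : Camera) : Matrix (Fin 6) (Fin 3) ℂ := joinMat C.center * C.pinv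

/-- The joint image map in terms of Chow forms of degree `d`,
`β ↦ (ν_d^{5,2}(Ĉ_1)ᵀ β, …, ν_d^{5,2}(Ĉ_n)ᵀ β)`. -/
def chowProj {n : ℕ} (C : Fin n → Camera) (d : ℕ) (β : Mon 5 d → ℂ) : Fin n → Mon 2 d → ℂ :=
  fun i => (veroneseMat (h := 5) (N := 2) d (C i).hat).transpose.mulVec β

/-! ### Plane curves -/

/-- The matrix `Ĥ(h)`: it sends a line to its intersection point with the plane `h`, of which it
records the last three coordinates. -/
def planeHat (h : Fin 4 → ℂ) : Matrix (Fin 3) (Fin 6) ℂ :=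
  !![h 0, 0, 0, -h 2, -h 3, 0;
     0, h 0, 0, h 1, 0, -h 3;
     0, 0, h 0, 0, h 1, h 2]

/-- The Chow embedding `ι_d` of `(ℙ^3)^* × ℙ^{(d+2 choose 2)-1}`: it sends a plane `h` and a plane
curve `α` of degree `d` to the Chow form `ν_d^{2,5}(Ĥ(h))ᵀ α`. -/
def planeChow (d : ℕ) (h : Fin 4 → ℂ) (α : Mon 2 d → ℂ) : Mon 5 d → ℂ :=
  (veroneseMat (h := 2) (N := 5) d (planeHat h)).transpose.mulVec α

/-- The degree-`d` plane curve multiview variety: the Zariski closure of the image of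
`Φ_{C,d} : (ℙ^3)^* × ℙ^{(d+2 choose 2)-1} ⇢ (ℙ^{(d+2 choose 2)-1})^n`, the composition of `ι_d`
with the joint image map. -/
def planeCurveMultiviewVariety {n : ℕ} (C : Fin n → Camera) (d : ℕ) :
    Set (MultiProj n (Mon 2 d)) :=
  closure (ratImage {t : (Fin 4 → ℂ) × (Mon 2 d → ℂ) | t.1 ≠ 0 ∧ t.2 ≠ 0}
    fun t => chowProj C d (planeChow d t.1 t.2))

/-! ### Twisted cubics -/

/-- The pairs of columns that belong to the six Plücker coordinates. -/
def pluckerIdx : Fin 6 → Fin 4 × Fin 4 :=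
  ![(0, 1), (0, 2), (0, 3), (1, 2), (1, 3), (2, 3)]

/-- The second exterior power `∧²M`, the matrix of `2 × 2` minors of `M`. -/
def wedgeTwo (M : Matrix (Fin 4) (Fin 4) ℂ) : Matrix (Fin 6) (Fin 6) ℂ :=
  Matrix.of fun a b =>
    M (pluckerIdx a).1 (pluckerIdx b).1 * M (pluckerIdx a).2 (pluckerIdx b).2 -
      M (pluckerIdx a).1 (pluckerIdx b).2 * M (pluckerIdx a).2 (pluckerIdx b).1

/-- The signed permutation `Σ` between primal and dual Plücker coordinates. -/
def dualMat : Matrix (Fin 6) (Fin 6) ℂ :=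
  !![0, 0, 0, 0, 0, 1;
     0, 0, 0, 0, -1, 0;
     0, 0, 0, 1, 0, 0;
     0, 0, 1, 0, 0, 0;
     0, -1, 0, 0, 0, 0;
     1, 0, 0, 0, 0, 0]

open MvPolynomial in
/-- The Chow form of the standard twisted cubic `(s³ : s²t : st² : t³)`, as a cubic polynomial in
the Plücker coordinates of a line. -/
def twistedCubicForm : MvPolynomial (Fin 6) ℂ :=
  -X 3 ^ 3 - X 3 ^ 2 * X 2 + 2 * X 4 * X 3 * X 1 - X 5 * X 1 ^ 2 - X 4 ^ 2 * X 0
    + X 5 * X 3 * X 0 + X 5 * X 2 * X 0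

/-- The coefficient vector `ω^tw` of the Chow form of the standard twisted cubic. -/
def omegaTw : Mon 5 3 → ℂ := fun m => MvPolynomial.coeff m.1 twistedCubicForm

/-- The matrix `M(m)` for `m ∈ ℙ^12`. -/
def twMat (m : Fin 13 → ℂ) : Matrix (Fin 4) (Fin 4) ℂ :=
  !![0, m 0, m 1, m 2;
     -m 0, 0, m 3, m 4;
     m 5, m 6, m 7, m 8;
     m 9, m 10, m 11, m 12]

/-- The map `ι_tw` on `ℙ^12`: it sends `m` to `ν_3^{5,5}(Σ ∧²(M(m)ᵀ) Σ)ᵀ ω^tw`, which for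
invertible `M(m)` is the Chow form of the image of the standard twisted cubic under `M(m)`. -/
def twChow (m : Fin 13 → ℂ) : Mon 5 3 → ℂ :=
  (veroneseMat (h := 5) (N := 5) 3
    (dualMat * wedgeTwo (twMat m).transpose * dualMat)).transpose.mulVec omegaTw

/-- The twisted cubic multiview variety: the Zariski closure of the image of
`Ψ_C : ℙ^12 ⇢ (ℙ^9)^n`, the composition of `ι_tw` with the joint image map. -/
def twistedCubicMultiviewVariety {n : ℕ} (C : Fin n → Camera) : Set (MultiProj n (Mon 2 3)) :=
  closure (ratImage {m : Fin 13 → ℂ | m ≠ 0} fun m => chowProj C 3 (twChow m))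

end

end MultiviewCurves

/-! ### Krull dimension of spaces and rings -/

section Dimension

open Topology TopologicalSpace

/-! Both varieties are closures of sets parametrised by polynomials on an affine space. A
multihomogeneous equation holds on such a closure exactly when its pullback to the parameters is the
zero polynomial (`mem_closure_iff_pull_ne_zero`). Irreducibility is then the fact that a polynomial
ring over `ℂ` is a domain (`isIrreducible_closure_polyImage`).

For the dimensions, the parameters are first dehomogenised, and it remains to see that the
parametrisation is generically finite. The coordinate ring of a chart is a subalgebra of the
rational function field of the parameters, and the chart has the same dimension as its spectrum
(`topologicalKrullDim_chart`), namely the transcendence degree. This is the number of parameters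
once every derivation that kills the affine coordinates is zero, which may be tested by the Jacobian
at a single point (`topologicalKrullDim_closure_polyImage`). Two cameras with distinct centers
suffice for the test.

For plane curves the test point is the Fermat curve in a plane that avoids both centers. Comparing
the first-order conditions of the two cameras gives an identity between a linear form times a
combination of partial derivatives and a multiple of the Fermat form. This fixes the plane
(`eq_zero_of_linear_mul_eq`), and the normalisation then fixes the curve
(`planeParam_tangent_eq_zero`).

For twisted cubics the test point is an invertible matrix `M` that carries `(1 : 0 : 0 : 1)` and `(0
: 1 : 1 : 0)` to the two centers. A tangent vector `M'` yields the linear vector field `N = M⁻¹ M'`,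
tangent to both cones over the standard cubic (`hasDerivAt_twForm_joinMat`). Then `N` lies in the
copy of `𝔤𝔩₂` tangent to the cubic (`tangent_of_projections`), and the normal form of the upper left
block of `M` leaves only `N = 0` (`eq_zero_of_twChow_tangent`). -/

theorem Topology.IsInducing.topologicalKrullDim_eq_of_closedPoints_subset_range {X Y : Type*}
    [TopologicalSpace X] [TopologicalSpace Y] [JacobsonSpace Y] {f : X → Y} (hf : IsInducing f)
    (hr : closedPoints Y ⊆ Set.range f) : topologicalKrullDim X = topologicalKrullDim Y := by
  refine le_antisymm hf.topologicalKrullDim_le ?_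
  -- In a Jacobson space `Z` is the closure of its closed points, and these lie in the range of `f`.
  -- So pulling back loses no closed set.
  have hcl : ∀ Z : Set Y, IsClosed Z → closure (f '' (f ⁻¹' Z)) = Z := by
    intro Z hZ
    refine subset_antisymm (closure_minimal (Set.image_preimage_subset _ _) hZ) ?_
    rw [Set.image_preimage_eq_inter_range]
    conv_lhs => rw [← JacobsonSpace.closure_inter_closedPoints hZ]
    exact closure_mono (Set.inter_subset_inter_right _ hr)
  have hirr : ∀ Z : IrreducibleCloseds Y, IsIrreducible (f ⁻¹' (Z : Set Y)) := by
    intro Z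
    have h1 : IsIrreducible (f '' (f ⁻¹' (Z : Set Y))) := by
      rw [← isIrreducible_iff_closure, hcl _ Z.isClosed]
      exact Z.isIrreducible
    refine ⟨h1.1.of_image, ?_⟩
    intro u v hu hv hxu hxv
    obtain ⟨u', hu', rfl⟩ := hf.isOpen_iff.1 hu
    obtain ⟨v', hv', rfl⟩ := hf.isOpen_iff.1 hv
    obtain ⟨x, hx1, hx2⟩ := hxu
    obtain ⟨y, hy1, hy2⟩ := hxv
    obtain ⟨z, ⟨w, hw, rfl⟩, hz⟩ := h1.2 u' v' hu' hv' ⟨f x, ⟨x, hx1, rfl⟩, hx2⟩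
      ⟨f y, ⟨y, hy1, rfl⟩, hy2⟩
    exact ⟨w, hw, hz⟩
  let g : IrreducibleCloseds Y → IrreducibleCloseds X := fun Z =>
    ⟨f ⁻¹' Z, hirr Z, Z.isClosed.preimage hf.continuous⟩
  refine Order.krullDim_le_of_strictMono g ?_
  refine Monotone.strictMono_of_injective
    (fun Z W h => Set.preimage_mono (f := f) (show (Z : Set Y) ⊆ W from h)) fun Z W h => ?_
  have h2 : f ⁻¹' (Z : Set Y) = f ⁻¹' (W : Set Y) :=
      congrArg (fun T : IrreducibleCloseds X => (T : Set X)) h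
  apply IrreducibleCloseds.ext
  rw [← hcl _ Z.isClosed, h2, hcl _ W.isClosed]

/-- If every point has an open neighbourhood of dimension at most `r`, so is the whole space. -/
theorem topologicalKrullDim_le_of_forall_exists_isOpen {X : Type*} [TopologicalSpace X]
    {r : WithBot ℕ∞} (h : ∀ x : X, ∃ U : Set X, IsOpen U ∧ x ∈ U ∧ topologicalKrullDim U ≤ r) :
    topologicalKrullDim X ≤ r := by
  refine iSup_le fun p => ?_
  -- A point of the smallest member of a chain lies in every member. So its neighbourhood meets them
  -- all, and restriction to it keeps the inclusions strict.
  obtain ⟨x, hx⟩ := p.head.isIrreducible.nonempty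
  obtain ⟨U, hU, hxU, hr⟩ := h x
  refine le_trans ?_ hr
  let e := IrreducibleCloseds.orderIsoOfIsOpenEmbedding (Subtype.val : U → X)
    hU.isOpenEmbedding_subtypeVal
  have hmem : ∀ i, ((Subtype.val : U → X) ⁻¹' (p i : Set X)).Nonempty := fun i =>
    ⟨⟨x, hxU⟩, LTSeries.head_le p i hx⟩
  let q : LTSeries (IrreducibleCloseds U) :=
    { length := p.length
      toFun := fun i => e.symm ⟨p i, hmem i⟩
      step := fun i => e.symm.strictMono (p.step i) }
  exact le_iSup (fun q : LTSeries (IrreducibleCloseds U) => (q.length : WithBot ℕ∞)) q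

/-- Incomparability makes contraction of primes strictly monotone; lying over and going up lift any
chain of `R`. -/
theorem Algebra.IsIntegral.ringKrullDim_eq {R S : Type*} [CommRing R] [CommRing S] [Algebra R S]
    [Algebra.IsIntegral R S] (hinj : Function.Injective (algebraMap R S)) :
    ringKrullDim S = ringKrullDim R := by
  refine le_antisymm ?_ ?_
  · refine Order.krullDim_le_of_strictMono (PrimeSpectrum.comap (algebraMap R S)) ?_
    intro p q hpq
    exact Ideal.IsIntegral.comap_lt_comap (R := R) (A := S) hpq
  · refine iSup_le fun l => ?_
    have : FaithfulSMul R S := (faithfulSMul_iff_algebraMap_injective R S).2 hinj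
    obtain ⟨P, hP, hP'⟩ := Ideal.nonempty_primesOver (S := S) l.head.asIdeal
    obtain ⟨L, hL, -, -⟩ := Ideal.exists_ltSeries_of_hasGoingUp l P
    rw [← hL]
    exact le_iSup (fun q : LTSeries (PrimeSpectrum S) => (q.length : WithBot ℕ∞)) L

/-- By Noether normalisation `A` is integral over a polynomial ring, and both invariants equal its
number of variables. -/
theorem ringKrullDim_eq_trdeg {k A : Type} [Field k] [CommRing A] [IsDomain A] [Algebra k A]
    [Algebra.FiniteType k A] {r : ℕ} (h : Algebra.trdeg k A = r) : ringKrullDim A = r := by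
  obtain ⟨s, g, hg, hi⟩ := exists_integral_inj_algHom_of_fg k A
  let : Algebra (MvPolynomial (Fin s) k) A := g.toRingHom.toAlgebra
  have : IsScalarTower k (MvPolynomial (Fin s) k) A :=
    IsScalarTower.of_algebraMap_eq fun x => (g.commutes x).symm
  have : Algebra.IsIntegral (MvPolynomial (Fin s) k) A := ⟨hi⟩
  rw [Algebra.IsIntegral.ringKrullDim_eq (R := MvPolynomial (Fin s) k) hg]
  have : FaithfulSMul (MvPolynomial (Fin s) k) A := (faithfulSMul_iff_algebraMap_injective _ _).2 hg
  have h2 := trdeg_add_eq k (MvPolynomial (Fin s) k) (A := A)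
  rw [h, MvPolynomial.trdeg_of_isDomain, trdeg_eq_zero] at h2
  simp at h2
  simp [h2]

end Dimension

namespace MultiviewCurves

/-! ### Multihomogeneous polynomials and closures of parametrised sets -/

section Zariski

open MvPolynomial Topology

variable {n : ℕ} {ι σ : Type}

theorem IsMultihomogeneous.mul {F G : MvPolynomial (Fin n × ι) ℂ} {D E : Fin n → ℕ}
    (hF : IsMultihomogeneous F D) (hG : IsMultihomogeneous G E) :
    IsMultihomogeneous (F * G) (D + E) :=
  IsWeightedHomogeneous.mul hF hG

theorem IsMultihomogeneous.X (i : Fin n) (j : ι) :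
    IsMultihomogeneous (X (i, j) : MvPolynomial (Fin n × ι) ℂ) (Pi.single i 1) :=
  isWeightedHomogeneous_X ℂ _ (i, j)

theorem IsMultihomogeneous.C (c : ℂ) :
    IsMultihomogeneous (C c : MvPolynomial (Fin n × ι) ℂ) 0 :=
  isWeightedHomogeneous_C _ c

theorem IsMultihomogeneous.prod_X (j : Fin n → ι) (D : Fin n → ℕ) :
    IsMultihomogeneous (∏ i, MvPolynomial.X (i, j i) ^ D i : MvPolynomial (Fin n × ι) ℂ) D := by
  have h := IsWeightedHomogeneous.prod (R := ℂ) (w := fun x : Fin n × ι => (Pi.single x.1 1 : Fin n → ℕ))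
    Finset.univ (fun i => (MvPolynomial.X (i, j i) ^ D i : MvPolynomial (Fin n × ι) ℂ))
    (fun i => D i • Pi.single i 1) fun i _ => (IsMultihomogeneous.X i (j i)).pow (D i)
  have h2 : ∑ i, D i • (Pi.single i 1 : Fin n → ℕ) = D := by
    ext k
    simp [Finset.sum_apply, Pi.single_apply]
  rwa [h2] at h

/-- A general `K` is needed because this is applied both to representatives over `ℂ` and to the
generic point over the function field of the parameters. -/
theorem IsMultihomogeneous.aeval_smul {K : Type} [CommRing K] [Algebra ℂ K]
    {F : MvPolynomial (Fin n × ι) ℂ} {D : Fin n → ℕ} (hF : IsMultihomogeneous F D)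
    (c : Fin n → K) (v : Fin n × ι → K) :
    aeval (fun x => c x.1 * v x) F = (∏ i, c i ^ D i) * aeval v F := by
  rw [aeval_def, aeval_def, eval₂_eq, eval₂_eq, Finset.mul_sum]
  refine Finset.sum_congr rfl fun e he => ?_
  have hD : ∀ i, D i = ∑ x ∈ e.support with x.1 = i, e x := by
    intro i
    rw [← hF (mem_support_iff.1 he), Finsupp.weight_apply, Finsupp.sum, Finset.sum_apply,
      Finset.sum_filter]
    refine Finset.sum_congr rfl fun x _ => ?_
    simp [Pi.single_apply, eq_comm]
  have h : ∏ i, c i ^ D i = ∏ x ∈ e.support, c x.1 ^ e x := by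
    rw [← Finset.prod_fiberwise e.support (fun x => x.1)]
    refine Finset.prod_congr rfl fun i _ => ?_
    rw [hD, ← Finset.prod_pow_eq_pow_sum]
    refine Finset.prod_congr rfl fun x hx => ?_
    rw [(Finset.mem_filter.1 hx).2]
  simp only [mul_pow, Finset.prod_mul_distrib]
  rw [h]
  ring

theorem MultiProj.evalRep_ne_zero_iff {F : MvPolynomial (Fin n × ι) ℂ} {D : Fin n → ℕ}
    (hF : IsMultihomogeneous F D) (v : Fin n → ι → ℂ) (hv : ∀ i, v i ≠ 0) :
    MultiProj.evalRep (fun i => Projectivization.mk ℂ (v i) (hv i)) F ≠ 0 ↔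
      eval (fun x => v x.1 x.2) F ≠ 0 := by
  have h : ∀ i, ∃ a : ℂˣ, a • (Projectivization.mk ℂ (v i) (hv i)).rep = v i := fun i =>
    (Projectivization.mk_eq_mk_iff ℂ _ _ (hv i) (Projectivization.rep_nonzero _)).1 (by simp)
  choose a ha using h
  have h2 := hF.aeval_smul (fun i => (a i : ℂ)) fun x => (Projectivization.mk ℂ (v x.1) (hv x.1)).rep x.2
  have h3 : (fun x : Fin n × ι => (a x.1 : ℂ) * (Projectivization.mk ℂ (v x.1) (hv x.1)).rep x.2) =
      fun x => v x.1 x.2 := by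
    ext x
    conv_rhs => rw [← ha x.1]
    rfl
  have h5 : ∀ w : Fin n × ι → ℂ, aeval w F = eval w F := fun w =>
    RingHom.congr_fun (coe_aeval_eq_eval w) F
  rw [h3, h5, h5] at h2
  have h4 : ∏ i, (a i : ℂ) ^ D i ≠ 0 := Finset.prod_ne_zero_iff.2 fun i _ => pow_ne_zero _ (a i).ne_zero
  rw [h2]
  simp [MultiProj.evalRep, h4]

theorem MultiProj.isOpen_evalRep_ne_zero {F : MvPolynomial (Fin n × ι) ℂ} {D : Fin n → ℕ}
    (hF : IsMultihomogeneous F D) : IsOpen {p : MultiProj n ι | p.evalRep F ≠ 0} :=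
  TopologicalSpace.isOpen_generateFrom_of_mem ⟨D, F, hF, rfl⟩

theorem MultiProj.isTopologicalBasis : TopologicalSpace.IsTopologicalBasis
    {U : Set (MultiProj n ι) | ∃ (D : Fin n → ℕ) (F : MvPolynomial (Fin n × ι) ℂ),
      IsMultihomogeneous F D ∧ U = {p | p.evalRep F ≠ 0}} where
  exists_subset_inter := by
    rintro _ ⟨D, F, hF, rfl⟩ _ ⟨E, G, hG, rfl⟩ p ⟨hp, hq⟩
    refine ⟨_, ⟨_, _, hF.mul hG, rfl⟩, ?_, ?_⟩
    · simpa [evalRep] using ⟨hp, hq⟩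
    · intro q hq
      simpa [evalRep] using hq
  sUnion_eq := by
    refine Set.eq_univ_of_forall fun p => ⟨_, ⟨0, C 1, IsMultihomogeneous.C 1, rfl⟩, ?_⟩
    simp [evalRep]
  eq_generateFrom := rfl

theorem exists_eval_ne_zero {q : MvPolynomial σ ℂ} (hq : q ≠ 0) : ∃ a, eval a q ≠ 0 := by
  by_contra! h
  exact hq (MvPolynomial.funext fun a => by simpa using h a)

/-- The set of points of `(ℙ^N)^n` parametrised by the polynomial vectors `f i`. -/
def polyImage (f : Fin n → ι → MvPolynomial σ ℂ) : Set (MultiProj n ι) :=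
  ratImage Set.univ fun a i j => eval a (f i j)

/-- Substitution of the polynomials `f i j` for the coordinates. -/
noncomputable def pull (f : Fin n → ι → MvPolynomial σ ℂ) :
    MvPolynomial (Fin n × ι) ℂ →ₐ[ℂ] MvPolynomial σ ℂ :=
  aeval fun x => f x.1 x.2

theorem eval_pull (f : Fin n → ι → MvPolynomial σ ℂ) (a : σ → ℂ) (F : MvPolynomial (Fin n × ι) ℂ) :
    eval a (pull f F) = eval (fun x => eval a (f x.1 x.2)) F := by
  induction F using MvPolynomial.induction_on with
  | C a => simp [pull]
  | add p q hp hq => simp [hp, hq]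
  | mul_X p x hp => rw [map_mul, map_mul, hp, map_mul]; simp [pull]

/-- A condition for being in the closure of a set that contains the parametrised points for
generic parameters. -/
theorem mem_closure_iff_pull_ne_zero {f : Fin n → ι → MvPolynomial σ ℂ} (hf : ∀ i, ∃ j, f i j ≠ 0)
    {q : MvPolynomial σ ℂ} (hq : q ≠ 0) {A : Set (MultiProj n ι)}
    (h1 : ratImage {a | eval a q ≠ 0} (fun a i j => eval a (f i j)) ⊆ A) (h2 : A ⊆ polyImage f)
    (p : MultiProj n ι) : p ∈ closure A ↔
      ∀ (D : Fin n → ℕ) (F : MvPolynomial (Fin n × ι) ℂ), IsMultihomogeneous F D →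
        p.evalRep F ≠ 0 → pull f F ≠ 0 := by
  rw [MultiProj.isTopologicalBasis.mem_closure_iff]
  constructor
  · intro h D F hF hp h0
    obtain ⟨_, hr1, hr2⟩ := h _ ⟨D, F, hF, rfl⟩ hp
    obtain ⟨a, -, ha, rfl⟩ := h2 hr2
    have h3 := (MultiProj.evalRep_ne_zero_iff hF _ ha).1 hr1
    rw [← eval_pull, h0] at h3
    simp at h3
  · rintro h _ ⟨D, F, hF, rfl⟩ hp
    choose j hj using hf
    -- The first factor keeps `F` non-zero, the second keeps the parameter in the allowed locus, and
    -- the product makes the map defined in every factor.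
    have h0 : pull f F * q * ∏ i, f i (j i) ≠ 0 :=
      mul_ne_zero (mul_ne_zero (h D F hF hp) hq) (Finset.prod_ne_zero_iff.2 fun i _ => hj i)
    obtain ⟨a, ha⟩ := exists_eval_ne_zero h0
    simp only [map_mul, map_prod, mul_ne_zero_iff, Finset.prod_ne_zero_iff] at ha
    have hne : ∀ i, (fun j => eval a (f i j)) ≠ 0 := fun i h => ha.2 i (Finset.mem_univ _)
      (congrFun h (j i))
    refine ⟨fun i => Projectivization.mk ℂ _ (hne i), ?_, h1 ⟨a, ha.1.2, hne, rfl⟩⟩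
    refine (MultiProj.evalRep_ne_zero_iff hF _ hne).2 ?_
    rw [← eval_pull]
    exact ha.1.1

theorem mem_closure_polyImage_iff {f : Fin n → ι → MvPolynomial σ ℂ} (hf : ∀ i, ∃ j, f i j ≠ 0)
    (p : MultiProj n ι) : p ∈ closure (polyImage f) ↔
      ∀ (D : Fin n → ℕ) (F : MvPolynomial (Fin n × ι) ℂ), IsMultihomogeneous F D →
        p.evalRep F ≠ 0 → pull f F ≠ 0 :=
  mem_closure_iff_pull_ne_zero hf one_ne_zero (by rintro _ ⟨a, -, h⟩; exact ⟨a, trivial, h⟩) subset_rfl p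

/-- The membership criterion mentions neither `A` nor `q`. This allows the passage from homogeneous
parameters to an affine chart of them. -/
theorem closure_eq_closure_polyImage {f : Fin n → ι → MvPolynomial σ ℂ}
    (hf : ∀ i, ∃ j, f i j ≠ 0) {q : MvPolynomial σ ℂ} (hq : q ≠ 0) {A : Set (MultiProj n ι)}
    (h1 : ratImage {a | eval a q ≠ 0} (fun a i j => eval a (f i j)) ⊆ A) (h2 : A ⊆ polyImage f) :
    closure A = closure (polyImage f) := by
  ext p
  rw [mem_closure_iff_pull_ne_zero hf hq h1 h2, mem_closure_polyImage_iff hf]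

/-- Basic open sets that meet the closure pull back to non-zero polynomials, whose product is again
non-zero, so some parameter value lands in both. -/
theorem isIrreducible_closure_polyImage {f : Fin n → ι → MvPolynomial σ ℂ}
    (hf : ∀ i, ∃ j, f i j ≠ 0) : IsIrreducible (closure (polyImage f)) := by
  have key : ∀ Q : MvPolynomial σ ℂ, Q ≠ 0 → ∃ a, ∃ h : ∀ i, (fun j => eval a (f i j)) ≠ 0,
      eval a Q ≠ 0 := by
    intro Q hQ
    choose j hj using hf
    obtain ⟨a, ha⟩ := exists_eval_ne_zero
      (mul_ne_zero hQ (Finset.prod_ne_zero_iff.2 fun i _ => hj i : ∏ i, f i (j i) ≠ 0))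
    simp only [map_mul, map_prod, mul_ne_zero_iff, Finset.prod_ne_zero_iff] at ha
    exact ⟨a, fun i h => ha.2 i (Finset.mem_univ _) (congrFun h (j i)), ha.1⟩
  constructor
  · obtain ⟨a, h, -⟩ := key 1 one_ne_zero
    exact ⟨_, subset_closure ⟨a, trivial, h, rfl⟩⟩
  · rintro u v hu hv ⟨p, hp, hpu⟩ ⟨r, hr, hrv⟩
    obtain ⟨_, ⟨D, F, hF, rfl⟩, hpF, hFu⟩ := MultiProj.isTopologicalBasis.exists_subset_of_mem_open hpu hu
    obtain ⟨_, ⟨E, G, hG, rfl⟩, hrG, hGv⟩ := MultiProj.isTopologicalBasis.exists_subset_of_mem_open hrv hv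
    have h1 := (mem_closure_polyImage_iff hf p).1 hp D F hF hpF
    have h2 := (mem_closure_polyImage_iff hf r).1 hr E G hG hrG
    obtain ⟨a, h, ha⟩ := key _ (mul_ne_zero h1 h2)
    rw [← map_mul, eval_pull] at ha
    have h3 := (MultiProj.evalRep_ne_zero_iff (hF.mul hG) _ h).2 ha
    simp only [MultiProj.evalRep, map_mul, mul_ne_zero_iff] at h3
    exact ⟨_, subset_closure ⟨a, trivial, h, rfl⟩, hFu h3.1, hGv h3.2⟩

end Zariski

/-! ### Affine charts and their coordinate rings -/

section Charts

open MvPolynomial Topology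

variable {n : ℕ} {ι σ : Type}

/-- Evaluation of a polynomial at the affine coordinates `w (i, k) / w (i, j i)`. -/
noncomputable def affineEval {K : Type} [Field K] [Algebra ℂ K] (j : Fin n → ι) (w : Fin n × ι → K) :
    MvPolynomial (Fin n × ι) ℂ →ₐ[ℂ] K :=
  aeval fun x => w x / w (x.1, j x.1)

theorem IsMultihomogeneous.aeval_eq_affineEval {K : Type} [Field K] [Algebra ℂ K]
    {F : MvPolynomial (Fin n × ι) ℂ} {D : Fin n → ℕ} (hF : IsMultihomogeneous F D)
    (j : Fin n → ι) (w : Fin n × ι → K) (hw : ∀ i, w (i, j i) ≠ 0) :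
    aeval w F = (∏ i, w (i, j i) ^ D i) * affineEval j w F := by
  rw [affineEval, ← hF.aeval_smul (fun i => w (i, j i))]
  congr 2
  ext x
  field_simp [hw x.1]

/-- Powers of the chart coordinates clear the denominators. All large multidegrees are allowed, so
that the two terms of a sum can be given the same one. -/
theorem exists_homogenization (j : Fin n → ι) (g : MvPolynomial (Fin n × ι) ℂ) :
    ∃ D₀ : Fin n → ℕ, ∀ D ≥ D₀, ∃ G, IsMultihomogeneous G D ∧
      ∀ (K : Type) [Field K] [Algebra ℂ K] (w : Fin n × ι → K), (∀ i, w (i, j i) ≠ 0) →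
        aeval w G = (∏ i, w (i, j i) ^ D i) * affineEval j w g := by
  induction g using MvPolynomial.induction_on with
  | C a =>
    refine ⟨0, fun D _ => ⟨C a * ∏ i, X (i, j i) ^ D i, ?_, ?_⟩⟩
    · simpa using (IsMultihomogeneous.C a).mul (IsMultihomogeneous.prod_X j D)
    · intro K _ _ w _
      simp [affineEval, mul_comm]
  | add p q hp hq =>
    obtain ⟨D₁, h₁⟩ := hp
    obtain ⟨D₂, h₂⟩ := hq
    refine ⟨D₁ ⊔ D₂, fun D hD => ?_⟩
    obtain ⟨P, hP, hP'⟩ := h₁ D (le_trans le_sup_left hD)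
    obtain ⟨Q, hQ, hQ'⟩ := h₂ D (le_trans le_sup_right hD)
    refine ⟨P + Q, IsWeightedHomogeneous.add hP hQ, ?_⟩
    intro K _ _ w hw
    rw [map_add, map_add, hP' K w hw, hQ' K w hw, mul_add]
  | mul_X p x hp =>
    obtain ⟨D₁, h₁⟩ := hp
    refine ⟨D₁ + Pi.single x.1 1, fun D hD => ?_⟩
    obtain ⟨E, rfl⟩ := exists_add_of_le hD
    obtain ⟨P, hP, hP'⟩ := h₁ (D₁ + E) le_self_add
    refine ⟨P * X x, ?_, ?_⟩
    · have := hP.mul (IsMultihomogeneous.X x.1 x.2)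
      rwa [add_right_comm] at this
    · intro K _ _ w hw
      have h : ∏ i, w (i, j i) ^ ((D₁ + Pi.single x.1 1 + E : Fin n → ℕ) i) =
          (∏ i, w (i, j i) ^ ((D₁ + E : Fin n → ℕ) i)) * w (x.1, j x.1) := by
        have h' : w (x.1, j x.1) = ∏ i, w (i, j i) ^ ((Pi.single x.1 1 : Fin n → ℕ) i) := by
          rw [Finset.prod_eq_single x.1]
          · simp
          · intro b _ hb; simp [hb]
          · simp
        rw [h', ← Finset.prod_mul_distrib]
        refine Finset.prod_congr rfl fun i _ => ?_
        rw [← pow_add, add_right_comm]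
        rfl
      have hx : affineEval j w (X x) = w x / w (x.1, j x.1) := by simp [affineEval]
      rw [map_mul, map_mul, hP' K w hw, h, aeval_X, hx]
      field_simp [hw x.1]

/-- The affine chart of `(ℙ^N)^n` on which the coordinates `x_{i, j i}` do not vanish. -/
def chart (j : Fin n → ι) : Set (MultiProj n ι) := {p | ∀ i, (p i).rep (j i) ≠ 0}

theorem mem_chart_iff (j : Fin n → ι) (p : MultiProj n ι) :
    p ∈ chart j ↔ p.evalRep (∏ i, X (i, j i) ^ (1 : Fin n → ℕ) i) ≠ 0 := by
  simp [MultiProj.evalRep, Finset.prod_eq_zero_iff, chart]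

theorem isOpen_chart (j : Fin n → ι) : IsOpen (chart j) := by
  have h : chart j = {p | p.evalRep (∏ i, X (i, j i) ^ (1 : Fin n → ℕ) i) ≠ 0} :=
    Set.ext fun p => mem_chart_iff j p
  rw [h]
  exact MultiProj.isOpen_evalRep_ne_zero (IsMultihomogeneous.prod_X j 1)

/-- The values of a polynomial in the affine coordinates of a chart. -/
noncomputable def MultiProj.chartEval (j : Fin n → ι) (p : MultiProj n ι) :
    MvPolynomial (Fin n × ι) ℂ →ₐ[ℂ] ℂ :=
  affineEval j fun x => (p x.1).rep x.2

theorem chartEval_ne_zero_iff {j : Fin n → ι} {p : MultiProj n ι} (hp : p ∈ chart j)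
    {F : MvPolynomial (Fin n × ι) ℂ} {D : Fin n → ℕ} (hF : IsMultihomogeneous F D) :
    p.chartEval j F ≠ 0 ↔ p.evalRep F ≠ 0 := by
  have h := hF.aeval_eq_affineEval j (fun x => (p x.1).rep x.2) hp
  rw [show aeval (fun x : Fin n × ι => (p x.1).rep x.2) F = p.evalRep F from
    RingHom.congr_fun (coe_aeval_eq_eval _) F] at h
  rw [h]
  have h2 : ∏ i, (p i).rep (j i) ^ D i ≠ 0 := Finset.prod_ne_zero_iff.2 fun i _ => pow_ne_zero _ (hp i)
  simp [h2, MultiProj.chartEval]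

/-- A single `G` serves the points of the chart and the generic point, so that vanishing at the two
can be compared. -/
theorem exists_homogenization_chart (j : Fin n → ι) (g : MvPolynomial (Fin n × ι) ℂ) :
    ∃ D G, IsMultihomogeneous G D ∧ (∀ p ∈ chart j, p.chartEval j g ≠ 0 ↔ p.evalRep G ≠ 0) ∧
      ∀ (K : Type) [Field K] [Algebra ℂ K] (w : Fin n × ι → K), (∀ i, w (i, j i) ≠ 0) →
        (affineEval j w g = 0 ↔ aeval w G = 0) := by
  obtain ⟨D, h⟩ := exists_homogenization j g
  obtain ⟨G, hG, hG'⟩ := h D le_rfl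
  have key : ∀ (K : Type) [Field K] [Algebra ℂ K] (w : Fin n × ι → K), (∀ i, w (i, j i) ≠ 0) →
        (affineEval j w g = 0 ↔ aeval w G = 0) := by
    intro K _ _ w hw
    have h2 : ∏ i, w (i, j i) ^ D i ≠ 0 := Finset.prod_ne_zero_iff.2 fun i _ => pow_ne_zero _ (hw i)
    rw [hG' K w hw]
    simp [h2]
  refine ⟨D, G, hG, fun p hp => ?_, key⟩
  have h := key ℂ (fun x => (p x.1).rep x.2) hp
  rw [show aeval (fun x : Fin n × ι => (p x.1).rep x.2) G = p.evalRep G from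
    RingHom.congr_fun (coe_aeval_eq_eval _) G] at h
  exact not_congr h

/-- The affine coordinates of the generic point of the parametrised variety. -/
noncomputable def genericEval (f : Fin n → ι → MvPolynomial σ ℂ) (j : Fin n → ι) :
    MvPolynomial (Fin n × ι) ℂ →ₐ[ℂ] FractionRing (MvPolynomial σ ℂ) :=
  affineEval j fun x => algebraMap (MvPolynomial σ ℂ) _ (f x.1 x.2)

theorem aeval_algebraMap_eq (f : Fin n → ι → MvPolynomial σ ℂ) (F : MvPolynomial (Fin n × ι) ℂ) :
    aeval (fun x => algebraMap (MvPolynomial σ ℂ) (FractionRing (MvPolynomial σ ℂ)) (f x.1 x.2)) F =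
      algebraMap _ _ (pull f F) := by
  induction F using MvPolynomial.induction_on with
  | C a =>
    rw [algHom_C, pull, algHom_C, ← IsScalarTower.algebraMap_apply]
  | add p q hp hq => simp [hp, hq]
  | mul_X p x hp => rw [map_mul, map_mul, hp, map_mul]; simp [pull]

theorem mem_closure_polyImage_iff_ker {f : Fin n → ι → MvPolynomial σ ℂ} {j : Fin n → ι}
    (hf : ∀ i, f i (j i) ≠ 0) {p : MultiProj n ι} (hp : p ∈ chart j) :
    p ∈ closure (polyImage f) ↔
      RingHom.ker (genericEval f j) ≤ RingHom.ker (p.chartEval j) := by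
  have hw : ∀ i, algebraMap (MvPolynomial σ ℂ) (FractionRing (MvPolynomial σ ℂ)) (f i (j i)) ≠ 0 :=
    fun i => by simpa using hf i
  rw [mem_closure_polyImage_iff fun i => ⟨_, hf i⟩]
  constructor
  · intro h g hg
    obtain ⟨D, G, hG, h1, h2⟩ := exists_homogenization_chart j g
    by_contra hne
    refine h D G hG ((h1 p hp).1 hne) ?_
    have h3 := (h2 _ (fun x => algebraMap _ _ (f x.1 x.2)) hw).1 hg
    rw [aeval_algebraMap_eq] at h3
    simpa using h3
  · intro h D F hF hpF h0
    rw [← chartEval_ne_zero_iff hp hF] at hpF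
    refine hpF (h ?_)
    have h3 := hF.aeval_eq_affineEval j (fun x => algebraMap _ (FractionRing (MvPolynomial σ ℂ)) (f x.1 x.2)) hw
    rw [aeval_algebraMap_eq, h0, map_zero] at h3
    have h4 : ∏ i, algebraMap (MvPolynomial σ ℂ) (FractionRing (MvPolynomial σ ℂ)) (f i (j i)) ^ D i ≠ 0 :=
      Finset.prod_ne_zero_iff.2 fun i _ => pow_ne_zero _ (hw i)
    exact (mul_eq_zero.1 h3.symm).resolve_left h4

/-- The affine coordinate ring of a chart of the closure of the parametrised set. -/
abbrev ChartRing (f : Fin n → ι → MvPolynomial σ ℂ) (j : Fin n → ι) : Type :=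
  MvPolynomial (Fin n × ι) ℂ ⧸ RingHom.ker (genericEval f j)

/-- Sending a point to the kernel of evaluation there induces the Zariski topology. By the
Nullstellensatz it reaches every closed point of the spectrum, which is a Jacobson space. -/
theorem topologicalKrullDim_chart [Finite ι] {f : Fin n → ι → MvPolynomial σ ℂ} {j : Fin n → ι}
    (hf : ∀ i, f i (j i) ≠ 0) :
    topologicalKrullDim
        ((Subtype.val : closure (polyImage f) → MultiProj n ι) ⁻¹' chart j : Set _) =
      ringKrullDim (ChartRing f j) := by
  rw [← PrimeSpectrum.topologicalKrullDim_eq_ringKrullDim]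
  set Z := closure (polyImage f)
  set X : Set Z := (Subtype.val : Z → MultiProj n ι) ⁻¹' chart j
  have hker : ∀ p : X, RingHom.ker (genericEval f j) ≤ RingHom.ker (p.1.1.chartEval j) := fun p =>
    (mem_closure_polyImage_iff_ker hf p.2).1 p.1.2
  let ev : X → ChartRing f j →+* ℂ := fun p =>
    Ideal.Quotient.lift _ (p.1.1.chartEval j : MvPolynomial (Fin n × ι) ℂ →+* ℂ) fun a ha => hker p ha
  have hev : ∀ p g, ev p (Ideal.Quotient.mk _ g) = p.1.1.chartEval j g := fun p g => rfl
  let E : X → PrimeSpectrum (ChartRing f j) := fun p => ⟨RingHom.ker (ev p), RingHom.ker_isPrime _⟩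
  have hE : IsInducing E := by
    constructor
    refine le_antisymm ?_ ?_
    · rw [← continuous_iff_le_induced, PrimeSpectrum.isTopologicalBasis_basic_opens.continuous_iff]
      rintro _ ⟨a, rfl⟩
      obtain ⟨g, rfl⟩ := Ideal.Quotient.mk_surjective a
      obtain ⟨D, G, hG, h1, -⟩ := exists_homogenization_chart j g
      have h2 : E ⁻¹' (PrimeSpectrum.basicOpen (Ideal.Quotient.mk (RingHom.ker (genericEval f j)) g) : Set _) =
          (fun p : X => p.1.1) ⁻¹' {p | p.evalRep G ≠ 0} := by
        ext p
        exact h1 p.1.1 p.2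
      rw [h2]
      exact (MultiProj.isOpen_evalRep_ne_zero hG).preimage
        (continuous_subtype_val.comp continuous_subtype_val)
    · rw [← continuous_id_iff_le]
      have h3 : Continuous[TopologicalSpace.induced E inferInstance, MultiProj.zariskiTopology n ι]
          (fun p : X => p.1.1) := by
        rw [continuous_generateFrom_iff]
        rintro _ ⟨D, F, hF, rfl⟩
        refine ⟨(PrimeSpectrum.basicOpen (Ideal.Quotient.mk (RingHom.ker (genericEval f j)) F) : Set _),
          PrimeSpectrum.isOpen_basicOpen, ?_⟩
        ext p
        exact chartEval_ne_zero_iff p.2 hF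
      exact continuous_induced_rng.2 (continuous_induced_rng.2 h3)
  refine hE.topologicalKrullDim_eq_of_closedPoints_subset_range ?_
  intro q hq
  have hmax : q.asIdeal.IsMaximal := (PrimeSpectrum.isClosed_singleton_iff_isMaximal q).1 hq
  have hM := Ideal.comap_isMaximal_of_surjective (Ideal.Quotient.mk (RingHom.ker (genericEval f j)))
    Ideal.Quotient.mk_surjective (K := q.asIdeal)
  obtain ⟨x, hx⟩ := isMaximal_iff_eq_vanishingIdeal_singleton.1 hM
  have hx' : ∀ g, Ideal.Quotient.mk _ g ∈ q.asIdeal ↔ eval x g = 0 := fun g => by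
    rw [← Ideal.mem_comap, hx, mem_vanishingIdeal_singleton_iff]
    exact Eq.congr_left (RingHom.congr_fun (coe_aeval_eq_eval x) g)
  -- The chart coordinate stays among the variables, but takes the value 1 at the generic point.
  -- Hence `x` consists of normalised homogeneous coordinates.
  have hx1 : ∀ i, x (i, j i) = 1 := by
    intro i
    have h : (MvPolynomial.X (i, j i) - 1 : MvPolynomial (Fin n × ι) ℂ) ∈
        RingHom.ker (genericEval f j) := by
      simp [RingHom.mem_ker, genericEval, affineEval, hf i]
    have h2 := (hx' (MvPolynomial.X (i, j i) - 1)).1 (by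
      rw [Ideal.Quotient.eq_zero_iff_mem.2 h]; exact zero_mem _)
    simpa [sub_eq_zero] using h2
  have hne : ∀ i, (fun k => x (i, k)) ≠ 0 := fun i h => by simpa [hx1] using congrFun h (j i)
  let p : MultiProj n ι := fun i => Projectivization.mk ℂ (fun k => x (i, k)) (hne i)
  have hp : ∀ i, ∃ a : ℂˣ, ∀ k, (a : ℂ) * (p i).rep k = x (i, k) := fun i => by
    obtain ⟨a, ha⟩ := (Projectivization.mk_eq_mk_iff ℂ _ _ (hne i)
      (Projectivization.rep_nonzero (p i))).1 (by simp [p])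
    exact ⟨a, fun k => congrFun ha k⟩
  have hpc : p ∈ chart j := by
    intro i h0
    obtain ⟨a, ha⟩ := hp i
    have := ha (j i)
    rw [h0, hx1] at this
    simp at this
  have hpe : ∀ g, p.chartEval j g = eval x g := by
    intro g
    have h : (fun y : Fin n × ι => (p y.1).rep y.2 / (p y.1).rep (j y.1)) = x := by
      funext y
      obtain ⟨a, ha⟩ := hp y.1
      have h1 := ha (j y.1)
      rw [hx1] at h1
      have h2 : x y = (a : ℂ) * (p y.1).rep y.2 := (ha y.2).symm
      rw [div_eq_iff (hpc y.1), h2, mul_right_comm, h1, one_mul]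
    rw [MultiProj.chartEval, affineEval, h]
    exact RingHom.congr_fun (coe_aeval_eq_eval x) g
  have hpZ : p ∈ Z := by
    refine (mem_closure_polyImage_iff_ker hf hpc).2 fun g hg => ?_
    rw [RingHom.mem_ker, hpe, ← hx', Ideal.Quotient.eq_zero_iff_mem.2 hg]
    exact zero_mem _
  refine ⟨⟨⟨p, hpZ⟩, hpc⟩, ?_⟩
  refine PrimeSpectrum.ext (Ideal.ext fun a => ?_)
  obtain ⟨g, rfl⟩ := Ideal.Quotient.mk_surjective a
  rw [hx', ← hpe]
  exact RingHom.mem_ker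

end Charts

/-! ### A Jacobian criterion for the dimension of a parametrised variety -/

section Criterion

open MvPolynomial Topology

variable {n : ℕ} {ι σ : Type}

theorem trdeg_subalgebra_eq {k K : Type} [Field k] [Field K] [Algebra k K] (A : Subalgebra k K)
    [Algebra.IsAlgebraic A K] : Algebra.trdeg k A = Algebra.trdeg k K := by
  have : FaithfulSMul k A := (faithfulSMul_iff_algebraMap_injective _ _).2 (algebraMap k A).injective
  rw [← trdeg_add_eq k A (A := K), trdeg_eq_zero (R := A), add_zero]

/-- The coordinate ring of a chart is the range of `genericEval`. Algebraicity gives it the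
transcendence degree of the whole rational function field, and the charts cover. -/
theorem topologicalKrullDim_closure_polyImage_of_isAlgebraic [Finite ι] [Fintype σ]
    {f : Fin n → ι → MvPolynomial σ ℂ} (hf : ∀ i, ∃ j, f i j ≠ 0)
    (halg : ∀ j : Fin n → ι, (∀ i, f i (j i) ≠ 0) →
      Algebra.IsAlgebraic (genericEval f j).range (FractionRing (MvPolynomial σ ℂ))) :
    topologicalKrullDim (closure (polyImage f)) = Fintype.card σ := by
  have hchart : ∀ j : Fin n → ι, (∀ i, f i (j i) ≠ 0) → topologicalKrullDim
      ((Subtype.val : closure (polyImage f) → MultiProj n ι) ⁻¹' chart j : Set _) =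
        Fintype.card σ := by
    intro j hj
    rw [topologicalKrullDim_chart hj]
    have : (RingHom.ker (genericEval f j)).IsPrime := RingHom.ker_isPrime _
    refine ringKrullDim_eq_trdeg (k := ℂ) ?_
    have := halg j hj
    rw [(Ideal.quotientKerEquivRange (genericEval f j)).trdeg_eq]
    have : Algebra.IsAlgebraic (MvPolynomial σ ℂ) (FractionRing (MvPolynomial σ ℂ)) :=
      IsLocalization.isAlgebraic _ (nonZeroDivisors (MvPolynomial σ ℂ))
    rw [trdeg_subalgebra_eq, ← trdeg_add_eq ℂ (MvPolynomial σ ℂ),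
      trdeg_eq_zero (R := MvPolynomial σ ℂ), MvPolynomial.trdeg_of_isDomain]
    simp
  refine le_antisymm (topologicalKrullDim_le_of_forall_exists_isOpen fun p => ?_) ?_
  · have hj : ∀ i, ∃ k, (p.1 i).rep k ≠ 0 := fun i => by
      by_contra! h
      exact Projectivization.rep_nonzero (p.1 i) (funext h)
    choose j hj using hj
    refine ⟨_, (isOpen_chart j).preimage continuous_subtype_val, hj, (hchart j fun i => ?_).le⟩
    -- A coordinate that is non-zero at some point of the closure is not identically zero on the
    -- parameters.
    have h := (mem_closure_polyImage_iff hf p.1).1 p.2 _ _ (IsMultihomogeneous.X i (j i))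
      (by simpa [MultiProj.evalRep] using hj i)
    simpa [pull] using h
  · choose j hj using hf
    rw [← hchart j hj]
    exact topologicalKrullDim_subspace_le _ _

open scoped IntermediateField.algebraAdjoinAdjoin in
/-- If all derivations that vanish on `S` are trivial, then `K` is algebraic over `k(S)`. -/
theorem isAlgebraic_adjoin_of_derivation {k K : Type} [Field k] [CharZero k] [Field K] [Algebra k K]
    [Algebra.EssFiniteType k K] (S : Set K)
    (h : ∀ D : Derivation k K K, (∀ s ∈ S, D s = 0) → D = 0) :
    Algebra.IsAlgebraic (Algebra.adjoin k S) K := by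
  set L := IntermediateField.adjoin k S
  have : Algebra.EssFiniteType L K := Algebra.EssFiniteType.of_comp k L K
  have hu : Algebra.FormallyUnramified L K := by
    rw [Algebra.formallyUnramified_iff]
    -- A functional on `Ω[K⁄L]` composed with the universal derivation kills `S`, so it is zero.
    -- Hence `Ω[K⁄L]` vanishes, and an unramified, essentially finite extension is separable
    -- algebraic.
    have hdual : ∀ φ : Ω[K⁄L] →ₗ[K] K, φ = 0 := by
      intro φ
      refine Derivation.liftKaehlerDifferential_unique _ _ ?_
      have h0 := h ((φ.compDer (KaehlerDifferential.D L K)).restrictScalars k) fun s hs => by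
        have := (φ.compDer (KaehlerDifferential.D L K)).map_algebraMap
          (⟨s, IntermediateField.subset_adjoin k S hs⟩ : L)
        exact this
      ext x
      simpa using Derivation.congr_fun h0 x
    refine ⟨fun x y => sub_eq_zero.1 ?_⟩
    refine (Module.forall_dual_apply_eq_zero_iff K _).1 fun φ => ?_
    rw [hdual φ]
    rfl
  have : Algebra.IsSeparable L K := Algebra.FormallyUnramified.isSeparable L K
  have h1 : Algebra.IsAlgebraic L K := inferInstance
  exact (IsFractionRing.comap_isAlgebraic_iff (A := Algebra.adjoin k S) (K := L) (C := K)).2 h1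

theorem derivation_algebraMap_mvPolynomial [Fintype σ] {K : Type} [Field K] [Algebra ℂ K]
    [Algebra (MvPolynomial σ ℂ) K] [IsScalarTower ℂ (MvPolynomial σ ℂ) K]
    (D : Derivation ℂ K K) (p : MvPolynomial σ ℂ) :
    D (algebraMap _ K p) = ∑ s, algebraMap _ K (pderiv s p) * D (algebraMap (MvPolynomial σ ℂ) K (X s)) := by
  induction p using MvPolynomial.induction_on with
  | C a =>
    rw [← MvPolynomial.algebraMap_eq, ← IsScalarTower.algebraMap_apply]
    simp [MvPolynomial.algebraMap_eq]
  | add p q hp hq => simp [hp, hq, add_mul, Finset.sum_add_distrib]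
  | mul_X p x hp =>
    classical
    rw [map_mul, D.leibniz, hp]
    simp only [Derivation.leibniz, pderiv_X, smul_eq_mul, map_add, map_mul, add_mul,
      Finset.sum_add_distrib, Finset.mul_sum]
    congr 1
    · rw [Finset.sum_eq_single x]
      · simp
      · intro b _ hb; simp [hb.symm]
      · simp
    · exact Finset.sum_congr rfl fun s _ => by ring

theorem derivation_fractionRing_eq_zero [Fintype σ]
    (D : Derivation ℂ (FractionRing (MvPolynomial σ ℂ)) (FractionRing (MvPolynomial σ ℂ)))
    (h : ∀ s, D (algebraMap (MvPolynomial σ ℂ) _ (X s)) = 0) : D = 0 := by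
  have h1 : ∀ p : MvPolynomial σ ℂ, D (algebraMap _ _ p) = 0 := fun p => by
    rw [derivation_algebraMap_mvPolynomial]
    simp [h]
  ext x
  obtain ⟨p, q, hq, rfl⟩ := IsFractionRing.div_surjective (A := MvPolynomial σ ℂ) x
  have hq' : algebraMap (MvPolynomial σ ℂ) (FractionRing (MvPolynomial σ ℂ)) q ≠ 0 := by
    simpa using nonZeroDivisors.ne_zero hq
  have h2 := D.leibniz (algebraMap (MvPolynomial σ ℂ) (FractionRing (MvPolynomial σ ℂ)) q)
    (algebraMap (MvPolynomial σ ℂ) (FractionRing (MvPolynomial σ ℂ)) p / algebraMap _ _ q)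
  rw [mul_div_cancel₀ _ hq', h1, h1] at h2
  simpa [hq'] using h2.symm

/-- Links the formal Jacobian to derivatives along lines, in terms of which the tangent computations
are carried out. -/
theorem hasDerivAt_eval_line [Fintype σ] (a v : σ → ℂ) (p : MvPolynomial σ ℂ) :
    HasDerivAt (fun t : ℂ => eval (fun s => a s + t * v s) p)
      (∑ s, eval a (pderiv s p) * v s) 0 := by
  induction p using MvPolynomial.induction_on with
  | C a => simpa using hasDerivAt_const (0 : ℂ) a
  | add p q hp hq => simp only [map_add, add_mul, Finset.sum_add_distrib]; exact hp.add hq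
  | mul_X p x hp =>
    classical
    have h1 : HasDerivAt (fun t : ℂ => a x + t * v x) (v x) 0 := by
      simpa using ((hasDerivAt_id (0 : ℂ)).mul_const (v x)).const_add (a x)
    have h2 := hp.mul h1
    simp only [zero_mul, add_zero] at h2
    simp only [map_mul, eval_X]
    convert! h2 using 1
    simp only [Derivation.leibniz, pderiv_X, smul_eq_mul, map_add, map_mul, add_mul, eval_X,
      Finset.sum_add_distrib, Finset.sum_mul]
    rw [add_comm]
    congr 1
    · exact Finset.sum_congr rfl fun s _ => by ring
    · rw [Finset.sum_eq_single x]
      · simp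
      · intro b _ hb; simp [hb.symm]
      · simp

/-- A matrix of polynomials that is injective at one point is injective over the function field. -/
theorem mulVec_injective_of_eval {m l : Type} [Fintype m] [Fintype l] [DecidableEq l]
    [DecidableEq m] (J : Matrix m l (MvPolynomial σ ℂ)) (a : σ → ℂ)
    (h : Function.Injective (J.map (eval a)).mulVec) (w : l → FractionRing (MvPolynomial σ ℂ))
    (hw : (J.map (algebraMap _ (FractionRing (MvPolynomial σ ℂ)))).mulVec w = 0) : w = 0 := by
  -- A constant left inverse of the specialised matrix makes `J` square. The resulting determinant
  -- is 1 at `a`, hence a non-zero polynomial.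
  obtain ⟨G, hG⟩ : ∃ G : Matrix l m ℂ, G * J.map (eval a) = 1 := by
    obtain ⟨g, hg⟩ := (Matrix.toLin' (J.map (eval a))).exists_leftInverse_of_injective
      (LinearMap.ker_eq_bot.2 h)
    refine ⟨LinearMap.toMatrix' g, ?_⟩
    have h1 := congrArg LinearMap.toMatrix' hg
    rwa [LinearMap.toMatrix'_comp, LinearMap.toMatrix'_toLin', LinearMap.toMatrix'_id] at h1
  set N : Matrix l l (MvPolynomial σ ℂ) := (G.map C : Matrix l m (MvPolynomial σ ℂ)) * J
  have hN : N.map (eval a) = 1 := by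
    rw [← hG, Matrix.map_mul]
    congr 1
    ext i j
    simp
  have hdet : N.det ≠ 0 := by
    intro h0
    have h1 := congrArg (eval a) h0
    rw [RingHom.map_det, RingHom.mapMatrix_apply, hN] at h1
    simp at h1
  have hdet' : (N.map (algebraMap _ (FractionRing (MvPolynomial σ ℂ)))).det ≠ 0 := by
    rw [← RingHom.mapMatrix_apply, ← RingHom.map_det]
    simpa using hdet
  refine Matrix.eq_zero_of_mulVec_eq_zero hdet' ?_
  rw [Matrix.map_mul, ← Matrix.mulVec_mulVec, hw, Matrix.mulVec_zero]

/-- The dimension of a parametrised variety is the number of parameters if, at one point, no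
tangent vector is annihilated by the projective differentials of the factors `e b`. -/
theorem topologicalKrullDim_closure_polyImage [Fintype ι] [Fintype σ] {B : Type} [Fintype B]
    {f : Fin n → ι → MvPolynomial σ ℂ} (hf : ∀ i, ∃ j, f i j ≠ 0) (e : B → Fin n) (a : σ → ℂ)
    (hne : ∀ b, ∃ j, eval a (f (e b) j) ≠ 0)
    (h : ∀ (v : σ → ℂ) (c : B → ℂ), (∀ b j, HasDerivAt
      (fun t : ℂ => eval (fun s => a s + t * v s) (f (e b) j)) (c b * eval a (f (e b) j)) 0) →
        v = 0) :
    topologicalKrullDim (closure (polyImage f)) = Fintype.card σ := by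
  classical
  refine topologicalKrullDim_closure_polyImage_of_isAlgebraic hf fun j hj => ?_
  have hadj : (genericEval f j).range = Algebra.adjoin ℂ (Set.range fun x : Fin n × ι =>
      algebraMap (MvPolynomial σ ℂ) (FractionRing (MvPolynomial σ ℂ)) (f x.1 x.2) /
        algebraMap _ _ (f x.1 (j x.1))) :=
    (Algebra.adjoin_range_eq_range_aeval _ _).symm
  rw [hadj]
  have : Algebra.EssFiniteType (MvPolynomial σ ℂ) (FractionRing (MvPolynomial σ ℂ)) :=
    Algebra.EssFiniteType.of_isLocalization _ (nonZeroDivisors (MvPolynomial σ ℂ))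
  have : Algebra.EssFiniteType ℂ (FractionRing (MvPolynomial σ ℂ)) :=
    Algebra.EssFiniteType.comp ℂ (MvPolynomial σ ℂ) _
  refine isAlgebraic_adjoin_of_derivation _ fun D hD => derivation_fractionRing_eq_zero D ?_
  -- The Jacobian is augmented by one column per factor `b`. A kernel vector is a tangent direction
  -- along which each `f (e b)` moves only by a multiple of itself.
  let J : Matrix (B × ι) (σ ⊕ B) (MvPolynomial σ ℂ) := Matrix.of fun x => Sum.elim
    (fun s => pderiv s (f (e x.1) x.2)) fun b => if x.1 = b then -f (e x.1) x.2 else 0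
  have hJ : Function.Injective (J.map (eval a)).mulVec := by
    have hlin : Function.Injective (J.map (eval a)).mulVecLin := by
      rw [injective_iff_map_eq_zero]
      intro w hw
      have hrow : ∀ b k, ∑ s, eval a (pderiv s (f (e b) k)) * w (Sum.inl s) =
          w (Sum.inr b) * eval a (f (e b) k) := by
        intro b k
        have h1 := congrFun hw (b, k)
        simp [J, Matrix.mulVec, dotProduct, apply_ite (eval a), ite_mul] at h1
        linear_combination h1
      have hv := h (fun s => w (Sum.inl s)) (fun b => w (Sum.inr b)) fun b k => by
        rw [← hrow]
        exact hasDerivAt_eval_line _ _ _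
      have hv' : ∀ s, w (Sum.inl s) = 0 := fun s => congrFun hv s
      ext (s | b)
      · exact hv' s
      · obtain ⟨k, hk⟩ := hne b
        have h2 := hrow b k
        simp only [hv', mul_zero, Finset.sum_const_zero] at h2
        exact (mul_eq_zero.1 h2.symm).resolve_right hk
    exact hlin
  -- If `D` kills all quotients `f k / f j`, then `D (f k) = (D (f j) / f j) * f k`; the logarithmic
  -- derivatives fill the extra columns.
  have hz := mulVec_injective_of_eval J a hJ
    (Sum.elim (fun s => D (algebraMap (MvPolynomial σ ℂ) (FractionRing (MvPolynomial σ ℂ)) (X s)))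
    fun b => D (algebraMap (MvPolynomial σ ℂ) (FractionRing (MvPolynomial σ ℂ)) (f (e b) (j (e b)))) /
      algebraMap (MvPolynomial σ ℂ) (FractionRing (MvPolynomial σ ℂ)) (f (e b) (j (e b)))) (by
      ext ⟨b, k⟩
      have h1 := hD _ ⟨(e b, k), rfl⟩
      have hb : algebraMap (MvPolynomial σ ℂ) (FractionRing (MvPolynomial σ ℂ)) (f (e b) (j (e b))) ≠ 0 := by
        simpa using hj (e b)
      have h2 := D.leibniz (algebraMap (MvPolynomial σ ℂ) (FractionRing (MvPolynomial σ ℂ)) (f (e b) (j (e b))))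
        (algebraMap (MvPolynomial σ ℂ) (FractionRing (MvPolynomial σ ℂ)) (f (e b) k) /
          algebraMap (MvPolynomial σ ℂ) (FractionRing (MvPolynomial σ ℂ)) (f (e b) (j (e b))))
      rw [h1, mul_div_cancel₀ _ hb, derivation_algebraMap_mvPolynomial] at h2
      simp only [smul_eq_mul, mul_zero, zero_add] at h2
      simp only [J, Matrix.mulVec, dotProduct, Fintype.sum_sum_type, Matrix.map_apply,
        Matrix.of_apply, Sum.elim_inl, Sum.elim_inr, Pi.zero_apply]
      rw [h2, Finset.sum_eq_single b]
      · rw [if_pos rfl, map_neg]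
        ring
      · intro c _ hc
        rw [if_neg hc.symm, map_zero, zero_mul]
      · simp)
  intro s
  exact congrFun hz (Sum.inl s)

end Criterion

/-! ### Forms and their coefficient vectors -/

section Forms

open MvPolynomial

/-- The value of the form of degree `d` with coefficient vector `β`. -/
noncomputable def formEval {N d : ℕ} (β : Mon N d → ℂ) (x : Fin (N + 1) → ℂ) : ℂ :=
  β ⬝ᵥ veronese N d x

/-- Transposed Veronese matrices pull forms back along linear maps. So coefficient vectors can be
handled by substitution. -/
theorem formEval_transpose_mulVec {h N d : ℕ} (A : Matrix (Fin (h + 1)) (Fin (N + 1)) ℂ)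
    (β : Mon h d → ℂ) (x : Fin (N + 1) → ℂ) :
    formEval ((veroneseMat d A).transpose.mulVec β) x = formEval β (A.mulVec x) := by
  rw [formEval, formEval, veronese_mulVec, Matrix.dotProduct_mulVec, Matrix.mulVec_transpose]

theorem formEval_smul_right {N d : ℕ} (β : Mon N d → ℂ) (c : ℂ) (x : Fin (N + 1) → ℂ) :
    formEval β (c • x) = c ^ d * formEval β x := by
  rw [formEval, formEval, dotProduct, dotProduct, Finset.mul_sum]
  refine Finset.sum_congr rfl fun m _ => ?_
  have hm : ∑ j, m.1 j = d := (Finset.mem_finsuppAntidiag.1 m.2).1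
  have : veronese N d (c • x) m = c ^ d * veronese N d x m := by
    simp only [veronese, Pi.smul_apply, smul_eq_mul, mul_pow, Finset.prod_mul_distrib]
    rw [Finset.prod_pow_eq_pow_sum, hm]
  rw [this]
  ring

theorem eq_zero_of_formEval_eq_zero {N d : ℕ} {β : Mon N d → ℂ} (h : ∀ x, formEval β x = 0) :
    β = 0 := by
  have hz : (∑ m : Mon N d, monomial m.1 (β m) : MvPolynomial (Fin (N + 1)) ℂ) = 0 := by
    refine MvPolynomial.funext fun x => ?_
    rw [map_zero, ← h x, map_sum, formEval, dotProduct]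
    refine Finset.sum_congr rfl fun m _ => ?_
    rw [eval_monomial, Finsupp.prod_fintype _ _ (by simp)]
    rfl
  funext m
  have h1 := congrArg (coeff m.1) hz
  rw [coeff_sum, Finset.sum_eq_single m] at h1
  · simpa using h1
  · intro b _ hb
    rw [coeff_monomial, if_neg fun h => hb (Subtype.ext h)]
  · simp

theorem eq_of_formEval_eq {N d : ℕ} {β γ : Mon N d → ℂ} (h : ∀ x, formEval β x = formEval γ x) :
    β = γ := by
  refine sub_eq_zero.1 (eq_zero_of_formEval_eq_zero fun x => ?_)
  have := h x
  simp only [formEval] at this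
  rw [formEval, sub_dotProduct, this, sub_self]

theorem differentiable_formEval {N d : ℕ} (β : Mon N d → ℂ) : Differentiable ℂ (formEval β) := by
  unfold formEval veronese dotProduct
  fun_prop

end Forms

/-! ### Polynomial dependence on the parameters -/

section PolynomialMaps

open MvPolynomial

/-- A function that is given by a polynomial. -/
def IsPolyFun {σ : Type} (g : (σ → ℂ) → ℂ) : Prop := ∃ p : MvPolynomial σ ℂ, ∀ a, eval a p = g a

namespace IsPolyFun

variable {σ : Type} {g g' : (σ → ℂ) → ℂ}

theorem const (c : ℂ) : IsPolyFun fun _ : σ → ℂ => c := ⟨C c, by simp⟩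

theorem apply (s : σ) : IsPolyFun fun a : σ → ℂ => a s := ⟨X s, by simp⟩

theorem add (h : IsPolyFun g) (h' : IsPolyFun g') : IsPolyFun fun a => g a + g' a := by
  obtain ⟨p, hp⟩ := h; obtain ⟨q, hq⟩ := h'; exact ⟨p + q, by simp [hp, hq]⟩

theorem sub (h : IsPolyFun g) (h' : IsPolyFun g') : IsPolyFun fun a => g a - g' a := by
  obtain ⟨p, hp⟩ := h; obtain ⟨q, hq⟩ := h'; exact ⟨p - q, by simp [hp, hq]⟩

theorem mul (h : IsPolyFun g) (h' : IsPolyFun g') : IsPolyFun fun a => g a * g' a := by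
  obtain ⟨p, hp⟩ := h; obtain ⟨q, hq⟩ := h'; exact ⟨p * q, by simp [hp, hq]⟩

theorem neg (h : IsPolyFun g) : IsPolyFun fun a => -g a := by
  obtain ⟨p, hp⟩ := h; exact ⟨-p, by simp [hp]⟩

theorem sum {τ : Type} {s : Finset τ} {g : τ → (σ → ℂ) → ℂ} (h : ∀ t, IsPolyFun (g t)) :
    IsPolyFun fun a => ∑ t ∈ s, g t a := by
  choose p hp using h
  exact ⟨∑ t ∈ s, p t, by simp [hp]⟩

theorem matrix_mul {l m k : Type} [Fintype m] {A : (σ → ℂ) → Matrix l m ℂ}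
    {B : (σ → ℂ) → Matrix m k ℂ} (hA : ∀ i j, IsPolyFun fun a => A a i j)
    (hB : ∀ i j, IsPolyFun fun a => B a i j) (i : l) (j : k) :
    IsPolyFun fun a => (A a * B a) i j := by
  simp only [Matrix.mul_apply]
  exact sum fun t => (hA i t).mul (hB t j)

theorem matrix_mulVec {l m : Type} [Fintype m] {A : (σ → ℂ) → Matrix l m ℂ}
    {v : (σ → ℂ) → m → ℂ} (hA : ∀ i j, IsPolyFun fun a => A a i j)
    (hv : ∀ i, IsPolyFun fun a => v a i) (i : l) : IsPolyFun fun a => (A a).mulVec (v a) i := by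
  simp only [Matrix.mulVec, dotProduct]
  exact sum fun t => (hA i t).mul (hv t)

theorem veroneseMat_apply {h N d : ℕ} {A : (σ → ℂ) → Matrix (Fin (h + 1)) (Fin (N + 1)) ℂ}
    (hA : ∀ i j, IsPolyFun fun a => A a i j) (m : Mon h d) (m' : Mon N d) :
    IsPolyFun fun a => veroneseMat d (A a) m m' := by
  choose P hP using hA
  -- The same product is formed over the polynomial ring in the parameters; taking coefficients
  -- commutes with specialisation.
  refine ⟨coeff m'.1 (∏ i, (∑ j, C (P i j) * X j) ^ m.1 i :
    MvPolynomial (Fin (N + 1)) (MvPolynomial σ ℂ)), fun a => ?_⟩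
  rw [← coeff_map]
  simp only [map_prod, map_pow, map_sum, map_mul, map_C, map_X, hP]
  rfl

theorem chowProj_apply {n d : ℕ} (C : Fin n → Camera) {β : (σ → ℂ) → Mon 5 d → ℂ}
    (hβ : ∀ m, IsPolyFun fun a => β a m) (i : Fin n) (j : Mon 2 d) :
    IsPolyFun fun a => chowProj C d (β a) i j :=
  matrix_mulVec (A := fun _ => (veroneseMat (h := 5) (N := 2) d (C i).hat).transpose)
    (fun _ _ => const _) hβ j

end IsPolyFun

end PolynomialMaps

/-! ### Cameras and back-projected lines -/

section Cameras

theorem joinMat_mulVec (c X : Fin 4 → ℂ) : (joinMat c).mulVec X =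
    ![c 1 * X 0 - c 0 * X 1, c 2 * X 0 - c 0 * X 2, c 3 * X 0 - c 0 * X 3,
      c 2 * X 1 - c 1 * X 2, c 3 * X 1 - c 1 * X 3, c 3 * X 2 - c 2 * X 3] := by
  ext i
  fin_cases i <;> simp [joinMat, Matrix.mulVec, dotProduct, Fin.sum_univ_four] <;> ring

theorem Camera.exists_smul_center (C : Camera) {X : Fin 4 → ℂ} (hX : C.mat.mulVec X = 0) :
    ∃ t : ℂ, X = t • C.center := by
  have h1 : Module.finrank ℂ (LinearMap.ker C.mat.mulVecLin) = 1 := by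
    have h2 := LinearMap.finrank_range_add_finrank_ker C.mat.mulVecLin
    have h3 : Module.finrank ℂ (LinearMap.range C.mat.mulVecLin) = 3 := C.rank_eq
    simp at h2
    omega
  have hc : C.center ∈ LinearMap.ker C.mat.mulVecLin := C.mulVec_center
  obtain ⟨t, ht⟩ := (finrank_eq_one_iff_of_nonzero' (⟨C.center, hc⟩ : LinearMap.ker C.mat.mulVecLin)
    (fun h => C.center_ne_zero (congrArg Subtype.val h))).1 h1 ⟨X, hX⟩
  exact ⟨t, (congrArg Subtype.val ht).symm⟩

/-- `C†CX - X` lies in the kernel of `C`, so it is a multiple of the center, which the join with the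
center kills. Image forms can thus be evaluated at points `X` of space. -/
theorem Camera.hat_mulVec (C : Camera) (X : Fin 4 → ℂ) :
    C.hat.mulVec (C.mat.mulVec X) = (joinMat C.center).mulVec X := by
  have h : C.mat.mulVec (C.pinv.mulVec (C.mat.mulVec X) - X) = 0 := by
    rw [Matrix.mulVec_sub, Matrix.mulVec_mulVec, Matrix.mulVec_mulVec, C.mul_pinv,
      Matrix.one_mul, sub_self]
  obtain ⟨t, ht⟩ := C.exists_smul_center h
  rw [Camera.hat, ← Matrix.mulVec_mulVec, sub_eq_iff_eq_add.1 ht, Matrix.mulVec_add,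
    Matrix.mulVec_smul]
  have : (joinMat C.center).mulVec C.center = 0 := by
    rw [joinMat_mulVec]
    ext i
    fin_cases i <;> simp <;> ring
  rw [this, smul_zero, zero_add]

theorem formEval_chowProj {n d : ℕ} (C : Fin n → Camera) (β : Mon 5 d → ℂ) (i : Fin n)
    (X : Fin 4 → ℂ) : formEval (chowProj C d β i) ((C i).mat.mulVec X) =
      formEval β ((joinMat (C i).center).mulVec X) := by
  rw [chowProj, formEval_transpose_mulVec, Camera.hat_mulVec]

theorem centerPoint_eq_of_smul {C C' : Camera} {t : ℂ} (h : C.center = t • C'.center) :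
    C.centerPoint = C'.centerPoint := by
  have ht : t ≠ 0 := by
    rintro rfl
    exact C.center_ne_zero (by simpa using h)
  exact (Projectivization.mk_eq_mk_iff' ℂ _ _ _ _).2 ⟨t, h.symm⟩

theorem chowProj_smul {n d : ℕ} (C : Fin n → Camera) (c : ℂ) (β : Mon 5 d → ℂ) (i : Fin n) :
    chowProj C d (c • β) i = c • chowProj C d β i := by
  simp [chowProj, Matrix.mulVec_smul]

end Cameras

/-! ### Rescaling representatives and differentiating forms -/

section Images

variable {n : ℕ} {ι T : Type}

theorem mem_ratImage_of_smul {S : Set T} {f : T → Fin n → ι → ℂ} {t : T} (ht : t ∈ S)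
    {v : Fin n → ι → ℂ} (hv : ∀ i, v i ≠ 0) {c : ℂ} (hc : c ≠ 0) (h : ∀ i, f t i = c • v i) :
    (fun i => Projectivization.mk ℂ (v i) (hv i)) ∈ ratImage S f := by
  refine ⟨t, ht, fun i => ?_, ?_⟩
  · rw [h]
    exact smul_ne_zero hc (hv i)
  · funext i
    exact (Projectivization.mk_eq_mk_iff' ℂ _ _ _ _).2 ⟨c⁻¹, by rw [h, inv_smul_smul₀ hc]⟩

theorem hasDerivAt_formEval {d : ℕ} {N : ℕ} {β : ℂ → Mon N d → ℂ} {c : ℂ}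
    (h : ∀ m, HasDerivAt (fun t => β t m) (c * β 0 m) 0) (x : Fin (N + 1) → ℂ) :
    HasDerivAt (fun t => formEval (β t) x) (c * formEval (β 0) x) 0 := by
  have := HasDerivAt.fun_sum (u := Finset.univ) fun m _ => (h m).mul_const (veronese N d x m)
  simpa only [formEval, dotProduct, Finset.mul_sum, mul_assoc] using this

end Images

/-! ### Tangent vectors at a Fermat curve in a plane -/

section PlaneCurves

open MvPolynomial

/-- The combination `(h · X) c - (h · c) X` of `c` and `X` lies in the plane `h`; it is where their
line meets it. -/
theorem planeHat_mulVec_joinMat (h c X : Fin 4 → ℂ) :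
    (planeHat h).mulVec ((joinMat c).mulVec X) =
      fun k : Fin 3 => (h ⬝ᵥ X) * c k.succ - (h ⬝ᵥ c) * X k.succ := by
  rw [joinMat_mulVec]
  ext k
  fin_cases k <;> simp [planeHat, Matrix.mulVec, dotProduct, Fin.sum_univ_six, Fin.sum_univ_four] <;>
    ring

theorem formEval_chowProj_planeChow {n d : ℕ} (C : Fin n → Camera) (h : Fin 4 → ℂ)
    (α : Mon 2 d → ℂ) (i : Fin n) (X : Fin 4 → ℂ) :
    formEval (chowProj C d (planeChow d h α) i) ((C i).mat.mulVec X) =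
      formEval α fun k : Fin 3 => (h ⬝ᵥ X) * (C i).center k.succ - (h ⬝ᵥ (C i).center) * X k.succ := by
  rw [formEval_chowProj, planeChow, formEval_transpose_mulVec, planeHat_mulVec_joinMat]

theorem isPolyFun_planeHat {σ : Type} {h : (σ → ℂ) → Fin 4 → ℂ}
    (hh : ∀ i, IsPolyFun fun a => h a i) (i : Fin 3) (j : Fin 6) :
    IsPolyFun fun a => planeHat (h a) i j := by
  have h0 : IsPolyFun fun _ : σ → ℂ => (0 : ℂ) := .const 0
  fin_cases i <;> fin_cases j <;>
    first | exact h0 | exact hh _ | exact (hh _).neg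

theorem isPolyFun_planeChow {σ : Type} {d : ℕ} {h : (σ → ℂ) → Fin 4 → ℂ}
    (hh : ∀ i, IsPolyFun fun a => h a i) {α : (σ → ℂ) → Mon 2 d → ℂ}
    (hα : ∀ m, IsPolyFun fun a => α a m) (m : Mon 5 d) :
    IsPolyFun fun a => planeChow d (h a) (α a) m :=
  IsPolyFun.matrix_mulVec
    (A := fun a => (veroneseMat (h := 2) (N := 5) d (planeHat (h a))).transpose)
    (fun _ _ => IsPolyFun.veroneseMat_apply (isPolyFun_planeHat hh) _ _) hα m

theorem planeHat_smul (c : ℂ) (h : Fin 4 → ℂ) : planeHat (c • h) = c • planeHat h := by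
  ext i j
  fin_cases i <;> fin_cases j <;> simp [planeHat]

theorem planeChow_smul_smul (d : ℕ) (c e : ℂ) (h : Fin 4 → ℂ) (α : Mon 2 d → ℂ) :
    planeChow d (c • h) (e • α) = (c ^ d * e) • planeChow d h α := by
  refine eq_of_formEval_eq fun x => ?_
  rw [planeChow, formEval_transpose_mulVec, planeHat_smul, Matrix.smul_mulVec,
    formEval_smul_right]
  have h1 : ∀ (N : ℕ) (r : ℂ) (β : Mon N d → ℂ) (y : Fin (N + 1) → ℂ),
    formEval (r • β) y = r * formEval β y := fun N r β y => by simp [formEval, smul_dotProduct]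
  rw [h1, h1, planeChow, formEval_transpose_mulVec]
  ring

/-- The exponent of `y_k ^ d`. -/
noncomputable def powExp (d : ℕ) (k : Fin 3) : Mon 2 d :=
  ⟨Finsupp.single k d, by simp [Finset.mem_finsuppAntidiag, Finsupp.single_apply]⟩

theorem powExp_injective {d : ℕ} (hd : d ≠ 0) : Function.Injective (powExp d) := by
  intro k l h
  have h1 := congrArg Subtype.val h
  exact Finsupp.single_left_injective hd h1

theorem veronese_powExp {d : ℕ} (k : Fin 3) (y : Fin 3 → ℂ) :
    veronese 2 d y (powExp d k) = y k ^ d := by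
  rw [veronese, Finset.prod_eq_single k]
  · simp [powExp]
  · intro b _ hb
    simp [powExp, hb.symm]
  · simp

open Classical in
/-- The coefficients of the Fermat form `y_0 ^ d + y_1 ^ d + y_2 ^ d`. -/
noncomputable def fermat (d : ℕ) (m : Mon 2 d) : ℂ := ∑ k, if m = powExp d k then 1 else 0

theorem formEval_fermat (d : ℕ) (y : Fin 3 → ℂ) : formEval (fermat d) y = ∑ k, y k ^ d := by
  simp only [formEval, dotProduct, fermat, Finset.sum_mul]
  rw [Finset.sum_comm]
  refine Finset.sum_congr rfl fun k _ => ?_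
  simp [ite_mul, veronese_powExp]

theorem fermat_powExp {d : ℕ} (hd : d ≠ 0) (k : Fin 3) : fermat d (powExp d k) = 1 := by
  simp [fermat, (powExp_injective hd).eq_iff]

/-- The parameters of plane curves in an affine chart: the last three coordinates of the plane
`(1 : h_1 : h_2 : h_3)` and the coefficients of the curve other than that of `y_0 ^ d`, which is
normalised to `1`. -/
abbrev PlaneParam (d : ℕ) : Type := Fin 3 ⊕ {m : Mon 2 d // m ≠ powExp d 0}

/-- The plane with given affine coordinates. -/
def PlaneParam.plane {d : ℕ} (a : PlaneParam d → ℂ) : Fin 4 → ℂ :=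
  Fin.cons 1 fun k => a (Sum.inl k)

open Classical in
/-- The coefficient vector with given affine coordinates. -/
noncomputable def PlaneParam.curve {d : ℕ} (a : PlaneParam d → ℂ) (m : Mon 2 d) : ℂ :=
  if h : m = powExp d 0 then 1 else a (Sum.inr ⟨m, h⟩)

theorem card_planeParam (d : ℕ) : Fintype.card (PlaneParam d) = (d + 2).choose 2 + 2 := by
  have h1 : Fintype.card (Mon 2 d) = (d + 2).choose 2 := by
    rw [Fintype.card_coe, Finset.card_finsuppAntidiag_nat_eq_choose, Finset.card_univ,
      Fintype.card_fin, show 2 + 1 + d - 1 = d + 2 by omega, Nat.choose_symm_add]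
  have h2 : 0 < (d + 2).choose 2 := Nat.choose_pos (by omega)
  rw [Fintype.card_sum, Fintype.card_subtype_compl, Fintype.card_subtype_eq, h1, Fintype.card_fin]
  omega

theorem exists_plane (c c' : Fin 4 → ℂ) (hc : c ≠ 0) (hc' : c' ≠ 0) :
    ∃ h : Fin 3 → ℂ, (Fin.cons 1 h : Fin 4 → ℂ) ⬝ᵥ c ≠ 0 ∧ (Fin.cons 1 h : Fin 4 → ℂ) ⬝ᵥ c' ≠ 0 := by
  have key : ∀ c : Fin 4 → ℂ, c ≠ 0 → (C (c 0) + ∑ k : Fin 3, X k * C (c k.succ) :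
      MvPolynomial (Fin 3) ℂ) ≠ 0 := by
    intro c hc h0
    apply hc
    have h1 : ∀ x : Fin 3 → ℂ, c 0 + ∑ k, x k * c k.succ = 0 := fun x => by
      simpa using congrArg (eval x) h0
    have h2 : c 0 = 0 := by simpa using h1 0
    have h3 : ∀ k : Fin 3, c k.succ = 0 := fun k => by
      simpa [h2, Pi.single_apply] using h1 (Pi.single k 1)
    ext k
    exact Fin.cases h2 h3 k
  obtain ⟨h, hh⟩ := exists_eval_ne_zero (mul_ne_zero (key c hc) (key c' hc'))
  rw [map_mul, mul_ne_zero_iff] at hh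
  refine ⟨h, ?_, ?_⟩
  · simpa [dotProduct, Fin.sum_univ_succ] using hh.1
  · simpa [dotProduct, Fin.sum_univ_succ] using hh.2

/-- Evaluation at 0-1 vectors shows that the symmetric part of `v pᵀ` is `μ` times the identity. The
symmetric part has rank at most 2, so `μ = 0`. Then `v pᵀ` is skew of rank at most 1, hence zero. -/
theorem eq_zero_of_linear_mul_eq {d : ℕ} (hd : 2 ≤ d) {v p : Fin 3 → ℂ} {μ : ℂ}
    (h : ∀ z : Fin 3 → ℂ, (∑ k, v k * z k) * (∑ k, z k ^ (d - 1) * p k) = μ * ∑ k, z k ^ d)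
    (hp : p ≠ 0) : v = 0 := by
  have hd0 : d ≠ 0 := by omega
  have hd1 : d - 1 ≠ 0 := by omega
  have e0 := h ![1, 0, 0]
  have e1 := h ![0, 1, 0]
  have e2 := h ![0, 0, 1]
  have e3 := h ![1, 1, 0]
  have e4 := h ![1, 0, 1]
  have e5 := h ![0, 1, 1]
  simp [Fin.sum_univ_three, hd0, hd1] at e0 e1 e2 e3 e4 e5
  have h01 : v 0 * p 1 = -(v 1 * p 0) := by linear_combination e3 - e0 - e1
  have h02 : v 0 * p 2 = -(v 2 * p 0) := by linear_combination e4 - e0 - e2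
  have h12 : v 1 * p 2 = -(v 2 * p 1) := by linear_combination e5 - e1 - e2
  have a1 : μ ^ 2 = -(v 0 * p 1) ^ 2 := by
    linear_combination -(v 1 * p 1) * e0 - μ * e1 + (v 0 * p 1) * h01
  have a2 : μ ^ 2 = -(v 0 * p 2) ^ 2 := by
    linear_combination -(v 2 * p 2) * e0 - μ * e2 + (v 0 * p 2) * h02
  have a3 : μ ^ 2 = -(v 1 * p 2) ^ 2 := by
    linear_combination -(v 2 * p 2) * e1 - μ * e2 + (v 1 * p 2) * h12
  have a4 : (v 0 * p 1) * (v 1 * p 2) = (v 0 * p 2) * μ := by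
    linear_combination (v 0 * p 2) * e1
  have a5 : μ ^ 4 = 0 := by
    -- All three squares equal `-μ ^ 2`, so this reads `μ ^ 4 = -μ ^ 4`.
    have : (v 0 * p 1) ^ 2 * (v 1 * p 2) ^ 2 = (v 0 * p 2) ^ 2 * μ ^ 2 := by
      rw [← mul_pow, a4, mul_pow]
    have b1 : (v 0 * p 1) ^ 2 = -μ ^ 2 := by linear_combination a1
    have b2 : (v 0 * p 2) ^ 2 = -μ ^ 2 := by linear_combination a2
    have b3 : (v 1 * p 2) ^ 2 = -μ ^ 2 := by linear_combination a3
    rw [b1, b2, b3] at this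
    linear_combination this / 2
  have hμ : μ = 0 := by simpa using a5
  subst hμ
  have c1 : v 0 * p 1 = 0 := by simpa using a1.symm
  have c2 : v 0 * p 2 = 0 := by simpa using a2.symm
  have c3 : v 1 * p 2 = 0 := by simpa using a3.symm
  have c4 : v 1 * p 0 = 0 := by linear_combination h01 - c1
  have c5 : v 2 * p 0 = 0 := by linear_combination h02 - c2
  have c6 : v 2 * p 1 = 0 := by linear_combination h12 - c3
  have hall : ∀ i k, v i * p k = 0 := by
    intro i k
    fin_cases i <;> fin_cases k <;>
      first | exact e0 | exact e1 | exact e2 | exact c1 | exact c2 | exact c3 | exact c4 | exact c5 | exact c6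
  obtain ⟨k, hk⟩ := Function.ne_iff.1 hp
  ext i
  exact (mul_eq_zero.1 (hall i k)).resolve_right hk

/-- The parameters of the Fermat curve in a plane. -/
noncomputable def fermatParam (d : ℕ) (h : Fin 3 → ℂ) : PlaneParam d → ℂ :=
  Sum.elim h fun m => fermat d m.1

theorem curve_fermatParam {d : ℕ} (hd : d ≠ 0) (h : Fin 3 → ℂ) :
    PlaneParam.curve (fermatParam d h) = fermat d := by
  ext m
  by_cases hm : m = powExp d 0
  · simp [PlaneParam.curve, hm, fermat_powExp hd]
  · simp [PlaneParam.curve, hm, fermatParam]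

/-- The projective differential of the joint image map of plane curves at a Fermat curve in a
plane that avoids the centers is injective for two cameras with distinct centers. -/
theorem planeParam_tangent_eq_zero {n d : ℕ} (hd : 2 ≤ d) (C : Fin n → Camera) {i i' : Fin n}
    (hC : (C i).centerPoint ≠ (C i').centerPoint) {h : Fin 3 → ℂ}
    (hi : (Fin.cons 1 h : Fin 4 → ℂ) ⬝ᵥ (C i).center ≠ 0)
    (hi' : (Fin.cons 1 h : Fin 4 → ℂ) ⬝ᵥ (C i').center ≠ 0) (v : PlaneParam d → ℂ) (c c' : ℂ)
    (H : ∀ m, HasDerivAt (fun t : ℂ => chowProj C d (planeChow d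
      (PlaneParam.plane fun s => fermatParam d h s + t * v s)
      (PlaneParam.curve fun s => fermatParam d h s + t * v s)) i m)
      (c * chowProj C d (planeChow d (Fin.cons 1 h) (fermat d)) i m) 0)
    (H' : ∀ m, HasDerivAt (fun t : ℂ => chowProj C d (planeChow d
      (PlaneParam.plane fun s => fermatParam d h s + t * v s)
      (PlaneParam.curve fun s => fermatParam d h s + t * v s)) i' m)
      (c' * chowProj C d (planeChow d (Fin.cons 1 h) (fermat d)) i' m) 0) :
    v = 0 := by
  classical
  have hd0 : d ≠ 0 := by omega
  set α' : Mon 2 d → ℂ := fun m => if hm : m = powExp d 0 then 0 else v (Sum.inr ⟨m, hm⟩) with hα'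
  set w : Fin 3 → ℂ := fun k => v (Sum.inl k) with hw
  set h₀ : Fin 4 → ℂ := Fin.cons 1 h with hh₀
  have hplane : ∀ t : ℂ, PlaneParam.plane (fun s => fermatParam d h s + t * v s) =
      h₀ + t • (Fin.cons 0 w : Fin 4 → ℂ) := by
    intro t
    ext k
    refine Fin.cases ?_ (fun k => ?_) k <;> simp [PlaneParam.plane, fermatParam, hh₀, hw]
  have hcurve : ∀ t : ℂ, PlaneParam.curve (fun s => fermatParam d h s + t * v s) =
      fermat d + t • α' := by
    intro t
    ext m
    by_cases hm : m = powExp d 0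
    · simp [PlaneParam.curve, hm, hα', fermat_powExp hd0]
    · simp [PlaneParam.curve, hm, hα', fermatParam]
  -- the first-order condition for one camera
  have key : ∀ (k : Fin n) (b : ℂ), h₀ ⬝ᵥ (C k).center ≠ 0 →
      (∀ m, HasDerivAt (fun t : ℂ => chowProj C d (planeChow d
        (PlaneParam.plane fun s => fermatParam d h s + t * v s)
        (PlaneParam.curve fun s => fermatParam d h s + t * v s)) k m)
        (b * chowProj C d (planeChow d h₀ (fermat d)) k m) 0) →
      ∃ μ : ℂ, ∀ z : Fin 3 → ℂ, formEval α' z = μ * (∑ l, z l ^ d) + d * (∑ l, w l * z l) *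
        ∑ l, z l ^ (d - 1) * ((C k).center l.succ / (h₀ ⬝ᵥ (C k).center)) := by
    intro k b hk Hk
    set κ := h₀ ⬝ᵥ (C k).center with hκ'
    set η := (Fin.cons 0 w : Fin 4 → ℂ) ⬝ᵥ (C k).center with hη'
    -- The change `η` of the pairing with the center only rescales the Fermat form, so it is
    -- absorbed into the factor.
    refine ⟨b - d * η / κ, fun z => ?_⟩
    -- The point of the plane `h₀` with last coordinates `z`. There the curve is evaluated at `-κ •
    -- z` for `t = 0`, and the motion of the plane enters only through `∑ l, w l * z l`.
    set X : Fin 4 → ℂ := Fin.cons (-(∑ l, h l * z l)) z with hX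
    have hX0 : h₀ ⬝ᵥ X = 0 := by
      simp [dotProduct, Fin.sum_univ_succ, hh₀, hX]
    have hwX : (Fin.cons 0 w : Fin 4 → ℂ) ⬝ᵥ X = ∑ l, w l * z l := by
      simp [dotProduct, Fin.sum_univ_succ, hX]
    simp only [hplane, hcurve] at Hk
    have h1 := hasDerivAt_formEval (β := fun t => chowProj C d (planeChow d
      (h₀ + t • (Fin.cons 0 w : Fin 4 → ℂ)) (fermat d + t • α')) k) (c := b)
      (by simpa using Hk) ((C k).mat.mulVec X)
    simp only [formEval_chowProj_planeChow] at h1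
    set y : ℂ → Fin 3 → ℂ := fun t l =>
      (t * ∑ l, w l * z l) * (C k).center l.succ - (κ + t * η) * z l with hy
    have h2 : ∀ t : ℂ, (fun l : Fin 3 => ((h₀ + t • (Fin.cons 0 w : Fin 4 → ℂ)) ⬝ᵥ X) * (C k).center l.succ -
        ((h₀ + t • (Fin.cons 0 w : Fin 4 → ℂ)) ⬝ᵥ (C k).center) * X l.succ) = y t := by
      intro t
      ext l
      simp only [add_dotProduct, smul_dotProduct, hX0, hwX, smul_eq_mul, zero_add, hy]
      simp [hX, hκ', hη']
    simp only [h2] at h1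
    have h3 : ∀ t : ℂ, formEval (fermat d + t • α') (y t) =
        (∑ l, y t l ^ d) + t * formEval α' (y t) := by
      intro t
      rw [← formEval_fermat]
      simp [formEval, add_dotProduct, smul_dotProduct]
    simp only [h3] at h1
    have hy' : ∀ l, HasDerivAt (fun t => y t l) ((∑ l, w l * z l) * (C k).center l.succ - η * z l) 0 := by
      intro l
      have a1 := ((hasDerivAt_id (0 : ℂ)).mul_const (∑ l, w l * z l)).mul_const ((C k).center l.succ)
      have a2 := (((hasDerivAt_id (0 : ℂ)).mul_const η).const_add κ).mul_const (z l)
      simpa [hy] using a1.fun_sub a2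
    have hyd : DifferentiableAt ℂ (fun t => formEval α' (y t)) 0 := by
      refine (differentiable_formEval α').differentiableAt.comp (0 : ℂ) ?_
      exact differentiableAt_pi.2 fun l => (hy' l).differentiableAt
    have h4 := (HasDerivAt.fun_sum (u := Finset.univ) fun l _ => (hy' l).fun_pow d).add
      ((hasDerivAt_id (0 : ℂ)).mul hyd.hasDerivAt)
    have h5 := h1.unique h4
    have hy0 : y 0 = (-κ) • z := by
      ext l
      simp [hy]
    simp only [hy0, formEval_smul_right, id, zero_mul, add_zero, one_mul, Pi.smul_apply,
      smul_eq_mul, mul_pow] at h5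
    obtain ⟨d', rfl⟩ : ∃ d', d = d' + 1 := ⟨d - 1, by omega⟩
    have hκ : (-κ) ^ (d' + 1) ≠ 0 := pow_ne_zero _ (neg_ne_zero.2 hk)
    refine mul_left_cancel₀ hκ ?_
    simp only [Nat.add_sub_cancel] at h5 ⊢
    generalize (∑ l, w l * z l) = ℓ at h5 ⊢
    have hP : (-κ) ^ (d' + 1) = -κ * (-κ) ^ d' := pow_succ' _ _
    rw [hP] at h5 ⊢
    generalize (-κ) ^ d' = P at h5 ⊢
    simp only [Fin.sum_univ_three] at h5 ⊢
    have hk0 : κ ≠ 0 := hk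
    field_simp
    ring_nf at h5 ⊢
    linear_combination -h5
  obtain ⟨μ, hμ⟩ := key i c hi H
  obtain ⟨μ', hμ'⟩ := key i' c' hi' H'
  -- Subtracting the conditions of the two cameras cancels `α'`. The vector `p` is the difference of
  -- the centers scaled to pair to 1 with `h₀`, so it vanishes only if the centers coincide.
  have hw0 : w = 0 := by
    refine eq_zero_of_linear_mul_eq hd (μ := (μ' - μ) / d)
      (p := fun l => (C i).center l.succ / (h₀ ⬝ᵥ (C i).center) -
        (C i').center l.succ / (h₀ ⬝ᵥ (C i').center)) (fun z => ?_) fun hp => hC ?_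
    · have h1 := (hμ z).symm.trans (hμ' z)
      have hdc : (d : ℂ) ≠ 0 := by exact_mod_cast hd0
      simp only [mul_sub, Finset.sum_sub_distrib]
      rw [div_mul_eq_mul_div, eq_div_iff hdc]
      linear_combination h1
    · refine centerPoint_eq_of_smul (t := h₀ ⬝ᵥ (C i).center / h₀ ⬝ᵥ (C i').center) ?_
      have hs : ∀ l : Fin 3, (C i).center l.succ =
          h₀ ⬝ᵥ (C i).center / h₀ ⬝ᵥ (C i').center * (C i').center l.succ := fun l => by
        have := sub_eq_zero.1 (congrFun hp l)
        field_simp at this ⊢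
        linear_combination this
      have h0 : (C i).center 0 = h₀ ⬝ᵥ (C i).center / h₀ ⬝ᵥ (C i').center * (C i').center 0 := by
        have e1 : ∀ x : Fin 4 → ℂ, h₀ ⬝ᵥ x = x 0 + ∑ l, h l * x l.succ := fun x => by
          simp [dotProduct, Fin.sum_univ_succ, hh₀]
        have e2 : ∑ l, h l * (C i).center l.succ = h₀ ⬝ᵥ (C i).center / h₀ ⬝ᵥ (C i').center *
            ∑ l, h l * (C i').center l.succ := by
          rw [Finset.mul_sum]
          refine Finset.sum_congr rfl fun l _ => ?_
          rw [hs l]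
          ring
        have e3 := e1 (C i).center
        have e4 := e1 (C i').center
        have e5 := div_mul_cancel₀ (h₀ ⬝ᵥ (C i).center) hi'
        linear_combination -e3 - e2 - e5 + h₀ ⬝ᵥ (C i).center / h₀ ⬝ᵥ (C i').center * e4
      ext k
      exact Fin.cases h0 hs k
  have hα0 : α' (powExp d 0) = 0 := by simp [hα']
  -- Evaluation at `(1, 0, 0)` isolates the coefficient of `y_0 ^ d`, which the normalisation keeps
  -- constant.
  have hμ0 : μ = 0 := by
    have h1 := hμ (Pi.single 0 1)
    have h2 : formEval α' (Pi.single 0 1) = 0 := by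
      rw [formEval, dotProduct]
      refine Finset.sum_eq_zero fun m _ => ?_
      by_cases hm : m = powExp d 0
      · rw [hm, hα0, zero_mul]
      · have : ∃ k, k ≠ 0 ∧ m.1 k ≠ 0 := by
          by_contra! hk
          refine hm (Subtype.ext (Finsupp.ext fun k => ?_))
          have hs := (Finset.mem_finsuppAntidiag.1 m.2).1
          rw [Finset.sum_eq_single 0 (fun k _ h => hk k h) (by simp)] at hs
          by_cases h0 : k = 0
          · simp [powExp, h0, hs]
          · simp [powExp, hk k h0, Ne.symm h0]
        obtain ⟨k, hk0, hk⟩ := this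
        have hv : veronese 2 d (Pi.single 0 1) m = 0 :=
          Finset.prod_eq_zero (Finset.mem_univ k) (by simp [hk0, hk])
        rw [hv, mul_zero]
    rw [h2, hw0] at h1
    simpa [Fin.sum_univ_three, hd0] using h1.symm
  have hα : α' = 0 := eq_zero_of_formEval_eq_zero fun z => by
    rw [hμ, hw0, hμ0]
    simp
  ext (k | m)
  · exact congrFun hw0 k
  · have := congrFun hα m.1
    simpa [hα', m.2] using this

end PlaneCurves

/-! ### The plane curve multiview variety -/

section PlaneCurveVariety

open MvPolynomial

theorem chowProj_planeChow_fermat_ne_zero {n d : ℕ} (hd : d ≠ 0) (C : Fin n → Camera) (i : Fin n)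
    {h : Fin 3 → ℂ} (hi : (Fin.cons 1 h : Fin 4 → ℂ) ⬝ᵥ (C i).center ≠ 0) :
    chowProj C d (planeChow d (Fin.cons 1 h) (fermat d)) i ≠ 0 := by
  intro h0
  -- A point of the plane with last coordinates `(1, 0, 0)`: there the form takes the value `(-(h ·
  -- c)) ^ d`.
  set X : Fin 4 → ℂ := Fin.cons (-h 0) (Pi.single 0 1) with hX
  have h1 := formEval_chowProj_planeChow C (Fin.cons 1 h) (fermat d) i X
  have hX0 : (Fin.cons 1 h : Fin 4 → ℂ) ⬝ᵥ X = 0 := by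
    simp [dotProduct, Fin.sum_univ_succ, hX]
  rw [h0, hX0, formEval_fermat] at h1
  simp [formEval, hX, Fin.sum_univ_three, hd] at h1
  exact pow_ne_zero d (neg_ne_zero.2 hi) h1.symm

/-- The joint image map of plane curves in an affine chart of the parameter space. -/
theorem exists_planeParam_polynomials {n : ℕ} (C : Fin n → Camera) (d : ℕ) :
    ∃ f : Fin n → Mon 2 d → MvPolynomial (PlaneParam d) ℂ, ∀ a i j, eval a (f i j) =
      chowProj C d (planeChow d (PlaneParam.plane a) (PlaneParam.curve a)) i j := by
  have h : ∀ i j, IsPolyFun fun a : PlaneParam d → ℂ =>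
      chowProj C d (planeChow d (PlaneParam.plane a) (PlaneParam.curve a)) i j := fun i j => by
    refine IsPolyFun.chowProj_apply C (fun m => isPolyFun_planeChow (fun k => ?_) (fun m => ?_) m) i j
    · refine Fin.cases ?_ (fun k => ?_) k
      · exact .const 1
      · exact .apply _
    · by_cases hm : m = powExp d 0
      · simpa [PlaneParam.curve, hm] using IsPolyFun.const 1
      · simpa [PlaneParam.curve, hm] using IsPolyFun.apply _
  choose f hf using h
  exact ⟨f, fun a i j => hf i j a⟩

theorem exists_plane_polynomials {n : ℕ} (C : Fin n → Camera) (d : ℕ) :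
    ∃ F : Fin n → Mon 2 d → MvPolynomial (Fin 4 ⊕ Mon 2 d) ℂ, ∀ a i j, eval a (F i j) =
      chowProj C d (planeChow d (fun k => a (Sum.inl k)) (fun m => a (Sum.inr m))) i j := by
  have h : ∀ i j, IsPolyFun fun a : Fin 4 ⊕ Mon 2 d → ℂ =>
      chowProj C d (planeChow d (fun k => a (Sum.inl k)) (fun m => a (Sum.inr m))) i j :=
    fun i j => IsPolyFun.chowProj_apply C
      (fun m => isPolyFun_planeChow (fun k => .apply _) (fun m => .apply _) m) i j
  choose f hf using h
  exact ⟨f, fun a i j => hf i j a⟩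

theorem exists_coord_ne_zero {n : ℕ} {ι σ : Type} {f : Fin n → ι → MvPolynomial σ ℂ} {i : Fin n}
    {a : σ → ℂ} {v : ι → ℂ} (h : ∀ j, eval a (f i j) = v j) (hv : v ≠ 0) : ∃ j, f i j ≠ 0 := by
  obtain ⟨j, hj⟩ := Function.ne_iff.1 hv
  refine ⟨j, fun h0 => hj ?_⟩
  rw [← h, h0, map_zero]
  rfl

/-- The plane curve multiview variety is the closure of the set parametrised in an affine chart. -/
theorem planeCurveMultiviewVariety_eq {n d : ℕ} (hd : d ≠ 0) (C : Fin n → Camera)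
    {f : Fin n → Mon 2 d → MvPolynomial (PlaneParam d) ℂ} (hf : ∀ a i j, eval a (f i j) =
      chowProj C d (planeChow d (PlaneParam.plane a) (PlaneParam.curve a)) i j) :
    planeCurveMultiviewVariety C d = closure (polyImage f) := by
  obtain ⟨F, hF⟩ := exists_plane_polynomials C d
  have hF0 : ∀ i, ∃ j, F i j ≠ 0 := fun i => by
    obtain ⟨h, hi, -⟩ := exists_plane _ _ (C i).center_ne_zero (C i).center_ne_zero
    exact exists_coord_ne_zero (a := Sum.elim (Fin.cons 1 h) (fermat d)) (hF _ i)
      (chowProj_planeChow_fermat_ne_zero hd C i hi)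
  -- Both sets lie between the full homogeneous image and its part where the two normalised
  -- coordinates are non-zero, so both closures equal that of the full image.
  rw [planeCurveMultiviewVariety, closure_eq_closure_polyImage hF0
      (q := X (Sum.inl 0) * X (Sum.inr (powExp d 0))) (by simp [X_ne_zero]),
    ← closure_eq_closure_polyImage hF0
      (q := X (Sum.inl 0) * X (Sum.inr (powExp d 0))) (by simp [X_ne_zero])]
  · rintro _ ⟨a, ha, hne, rfl⟩
    have ha' : a (Sum.inl 0) ≠ 0 ∧ a (Sum.inr (powExp d 0)) ≠ 0 := by
      simpa [not_or] using ha
    refine mem_ratImage_of_smul (t := Sum.elim (fun k => a (Sum.inl k.succ) / a (Sum.inl 0))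
      fun m => a (Sum.inr m.1) / a (Sum.inr (powExp d 0))) (Set.mem_univ _) hne
      (c := (a (Sum.inl 0))⁻¹ ^ d * (a (Sum.inr (powExp d 0)))⁻¹)
      (mul_ne_zero (pow_ne_zero _ (inv_ne_zero ha'.1)) (inv_ne_zero ha'.2)) fun i => ?_
    have h1 : PlaneParam.plane (d := d) (Sum.elim (fun k => a (Sum.inl k.succ) / a (Sum.inl 0))
        fun m => a (Sum.inr m.1) / a (Sum.inr (powExp d 0))) =
          (a (Sum.inl 0))⁻¹ • fun k => a (Sum.inl k) := by
      ext k
      refine Fin.cases ?_ (fun k => ?_) k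
      · simp [PlaneParam.plane, ha'.1]
      · simp [PlaneParam.plane, div_eq_inv_mul]
    have h2 : PlaneParam.curve (d := d) (Sum.elim (fun k => a (Sum.inl k.succ) / a (Sum.inl 0))
        fun m => a (Sum.inr m.1) / a (Sum.inr (powExp d 0))) =
          (a (Sum.inr (powExp d 0)))⁻¹ • fun m => a (Sum.inr m) := by
      ext m
      by_cases hm : m = powExp d 0
      · simp [PlaneParam.curve, hm, ha'.2]
      · simp [PlaneParam.curve, hm, div_eq_inv_mul]
    ext j
    simp only [hf, hF, h1, h2, planeChow_smul_smul, chowProj_smul]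
  · rintro _ ⟨a, -, hne, rfl⟩
    refine ⟨Sum.elim (PlaneParam.plane a) (PlaneParam.curve a), trivial, ?_⟩
    have h1 : ∀ i, (fun j => eval (Sum.elim (PlaneParam.plane a) (PlaneParam.curve a)) (F i j)) =
        fun j => eval a (f i j) := fun i => by
      ext j
      rw [hF, hf]
      rfl
    simp only [h1]
    exact ⟨hne, rfl⟩
  · rintro _ ⟨a, ha, hne, rfl⟩
    have ha' : a (Sum.inl 0) ≠ 0 ∧ a (Sum.inr (powExp d 0)) ≠ 0 := by
      simpa [not_or] using ha
    refine ⟨(fun k => a (Sum.inl k), fun m => a (Sum.inr m)),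
      ⟨fun h => ha'.1 (congrFun h 0), fun h => ha'.2 (congrFun h (powExp d 0))⟩, ?_⟩
    have h1 : ∀ i, (fun j => eval a (F i j)) = chowProj C d (planeChow d (fun k => a (Sum.inl k))
        (fun m => a (Sum.inr m))) i := fun i => funext fun j => hF a i j
    simp only [h1] at hne ⊢
    exact ⟨hne, rfl⟩
  · rintro _ ⟨⟨h, α⟩, -, hne, rfl⟩
    refine ⟨Sum.elim h α, trivial, ?_⟩
    have h1 : ∀ i, (fun j => eval (Sum.elim h α) (F i j)) = chowProj C d (planeChow d h α) i :=
      fun i => funext fun j => hF _ i j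
    simp only [h1]
    exact ⟨hne, rfl⟩

theorem fermatParam_coord_ne_zero {n d : ℕ} (hd : d ≠ 0) (C : Fin n → Camera)
    {f : Fin n → Mon 2 d → MvPolynomial (PlaneParam d) ℂ} (hf : ∀ a i j, eval a (f i j) =
      chowProj C d (planeChow d (PlaneParam.plane a) (PlaneParam.curve a)) i j) {i : Fin n}
    {h : Fin 3 → ℂ} (hi : (Fin.cons 1 h : Fin 4 → ℂ) ⬝ᵥ (C i).center ≠ 0) :
    ∃ j, eval (fermatParam d h) (f i j) ≠ 0 := by
  obtain ⟨j, hj⟩ := Function.ne_iff.1 (chowProj_planeChow_fermat_ne_zero hd C i hi)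
  refine ⟨j, ?_⟩
  rw [hf, curve_fermatParam hd]
  exact hj

theorem isIrreducible_planeCurveMultiviewVariety {n d : ℕ} (hd : d ≠ 0) (C : Fin n → Camera) :
    IsIrreducible (planeCurveMultiviewVariety C d) := by
  obtain ⟨f, hf⟩ := exists_planeParam_polynomials C d
  rw [planeCurveMultiviewVariety_eq hd C hf]
  refine isIrreducible_closure_polyImage fun i => ?_
  obtain ⟨h, hi, -⟩ := exists_plane _ _ (C i).center_ne_zero (C i).center_ne_zero
  obtain ⟨j, hj⟩ := fermatParam_coord_ne_zero hd C hf hi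
  exact ⟨j, fun h0 => hj (by rw [h0, map_zero])⟩

theorem topologicalKrullDim_planeCurveMultiviewVariety {n d : ℕ} (hd : 2 ≤ d) (C : Fin n → Camera)
    {i i' : Fin n} (hC : (C i).centerPoint ≠ (C i').centerPoint) :
    topologicalKrullDim (planeCurveMultiviewVariety C d) = ((d + 2).choose 2 + 2 : ℕ) := by
  have hd0 : d ≠ 0 := by omega
  obtain ⟨f, hf⟩ := exists_planeParam_polynomials C d
  rw [planeCurveMultiviewVariety_eq hd0 C hf, ← card_planeParam]
  obtain ⟨h, hi, hi'⟩ := exists_plane _ _ (C i).center_ne_zero (C i').center_ne_zero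
  refine topologicalKrullDim_closure_polyImage (fun k => ?_) ![i, i'] (fermatParam d h) (fun b => ?_)
    fun v c H => ?_
  · obtain ⟨h, hk, -⟩ := exists_plane _ _ (C k).center_ne_zero (C k).center_ne_zero
    obtain ⟨j, hj⟩ := fermatParam_coord_ne_zero hd0 C hf hk
    exact ⟨j, fun h0 => hj (by rw [h0, map_zero])⟩
  · fin_cases b
    · exact fermatParam_coord_ne_zero hd0 C hf hi
    · exact fermatParam_coord_ne_zero hd0 C hf hi'
  · simp only [hf, curve_fermatParam hd0] at H
    exact planeParam_tangent_eq_zero hd C hC hi hi' v (c 0) (c 1) (H 0) (H 1)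

end PlaneCurveVariety

/-! ### The Chow form of the twisted cubic under linear maps -/

section TwistedCubics

open MvPolynomial

theorem formEval_coeff {N d : ℕ} {P : MvPolynomial (Fin (N + 1)) ℂ} (hP : P.IsHomogeneous d)
    (x : Fin (N + 1) → ℂ) : formEval (fun m : Mon N d => coeff m.1 P) x = eval x P := by
  have hsub : P.support ⊆ Finset.finsuppAntidiag Finset.univ d := by
    intro e he
    rw [Finset.mem_finsuppAntidiag]
    have := hP (mem_support_iff.1 he)
    refine ⟨?_, Finset.subset_univ _⟩
    rw [← this, Finsupp.weight_apply, Finsupp.sum_fintype _ _ (by simp)]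
    simp
  rw [eval_eq', Finset.sum_subset hsub, ← Finset.sum_coe_sort]
  · rfl
  · intro e _ hne
    rw [notMem_support_iff.1 hne, zero_mul]

/-- The Chow form of the standard twisted cubic as a function of Plücker coordinates. -/
def twForm (L : Fin 6 → ℂ) : ℂ :=
  -L 3 ^ 3 - L 3 ^ 2 * L 2 + 2 * L 4 * L 3 * L 1 - L 5 * L 1 ^ 2 - L 4 ^ 2 * L 0
    + L 5 * L 3 * L 0 + L 5 * L 2 * L 0

theorem isHomogeneous_twistedCubicForm : twistedCubicForm.IsHomogeneous 3 := by
  have hX := fun i : Fin 6 => isHomogeneous_X ℂ i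
  have h2 : (2 : MvPolynomial (Fin 6) ℂ).IsHomogeneous 0 := isHomogeneous_C (Fin 6) (2 : ℂ)
  unfold twistedCubicForm
  refine ((((((IsHomogeneous.neg ?_).sub ?_).add ?_).sub ?_).sub ?_).add ?_).add ?_
  · simpa using (hX 3).pow 3
  · simpa using ((hX 3).pow 2).mul (hX 2)
  · simpa using ((h2.mul (hX 4)).mul (hX 3)).mul (hX 1)
  · simpa using (hX 5).mul ((hX 1).pow 2)
  · simpa using ((hX 4).pow 2).mul (hX 0)
  · simpa using ((hX 5).mul (hX 3)).mul (hX 0)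
  · simpa using ((hX 5).mul (hX 2)).mul (hX 0)

theorem formEval_omegaTw (L : Fin 6 → ℂ) : formEval omegaTw L = twForm L := by
  refine (formEval_coeff (N := 5) isHomogeneous_twistedCubicForm L).trans ?_
  simp [twistedCubicForm, twForm]

theorem twForm_smul (r : ℂ) (L : Fin 6 → ℂ) : twForm (r • L) = r ^ 3 * twForm L := by
  simp only [twForm, Pi.smul_apply, smul_eq_mul]
  ring

/-- The transformation of lines that belongs to the inverse of `M`, up to scaling. -/
noncomputable def lineMat (M : Matrix (Fin 4) (Fin 4) ℂ) : Matrix (Fin 6) (Fin 6) ℂ :=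
  dualMat * wedgeTwo M.transpose * dualMat

theorem formEval_chowProj_twChow {n : ℕ} (C : Fin n → Camera) (m : Fin 13 → ℂ) (i : Fin n)
    (X : Fin 4 → ℂ) : formEval (chowProj C 3 (twChow m) i) ((C i).mat.mulVec X) =
      twForm ((lineMat (twMat m)).mulVec ((joinMat (C i).center).mulVec X)) := by
  rw [formEval_chowProj, twChow, formEval_transpose_mulVec, formEval_omegaTw]
  rfl

theorem lineMat_apply (M : Matrix (Fin 4) (Fin 4) ℂ) : lineMat M = Matrix.of fun a b =>
    dualMat a a.rev * wedgeTwo M.transpose a.rev b.rev * dualMat b.rev b := by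
  ext a b
  fin_cases a <;> fin_cases b <;>
    simp [lineMat, dualMat, Matrix.mul_apply, Matrix.vecMul, dotProduct, Fin.sum_univ_six, Fin.rev]

theorem det_eq_sum_mul_minors (M : Matrix (Fin 4) (Fin 4) ℂ) :
    M.det = (M 0 0 * M 1 1 - M 0 1 * M 1 0) * (M 2 2 * M 3 3 - M 2 3 * M 3 2)
      - (M 0 0 * M 1 2 - M 0 2 * M 1 0) * (M 2 1 * M 3 3 - M 2 3 * M 3 1)
      + (M 0 0 * M 1 3 - M 0 3 * M 1 0) * (M 2 1 * M 3 2 - M 2 2 * M 3 1)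
      + (M 0 1 * M 1 2 - M 0 2 * M 1 1) * (M 2 0 * M 3 3 - M 2 3 * M 3 0)
      - (M 0 1 * M 1 3 - M 0 3 * M 1 1) * (M 2 0 * M 3 2 - M 2 2 * M 3 0)
      + (M 0 2 * M 1 3 - M 0 3 * M 1 2) * (M 2 0 * M 3 1 - M 2 1 * M 3 0) := by
  rw [Matrix.det_succ_row_zero]
  simp [Fin.sum_univ_succ, Matrix.det_fin_three, Fin.succAbove]
  ring

/-- Each entry is a Laplace expansion: of `M.det` on the diagonal, and of a determinant with a
repeated column elsewhere. -/
theorem lineMat_mul_wedgeTwo (M : Matrix (Fin 4) (Fin 4) ℂ) :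
    lineMat M * wedgeTwo M = M.det • (1 : Matrix (Fin 6) (Fin 6) ℂ) := by
  rw [lineMat_apply, det_eq_sum_mul_minors]
  ext a b
  fin_cases a <;> fin_cases b <;>
    simp [dualMat, wedgeTwo, pluckerIdx, Matrix.mul_apply, Fin.sum_univ_six, Fin.rev] <;> ring

theorem joinMat_mulVec_mul (M : Matrix (Fin 4) (Fin 4) ℂ) (p : Fin 4 → ℂ) :
    joinMat (M.mulVec p) * M = wedgeTwo M * joinMat p := by
  ext a b
  fin_cases a <;> fin_cases b <;>
    simp [joinMat, wedgeTwo, pluckerIdx, Matrix.mul_apply, Fin.sum_univ_six, Fin.sum_univ_four,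
      Matrix.mulVec, dotProduct] <;> ring

/-- `wedgeTwo M` carries the join of `p` and `Y` to that of their images, and `lineMat M` undoes it
up to the determinant. This reduces every computation to the standard cubic. -/
theorem twForm_lineMat (M : Matrix (Fin 4) (Fin 4) ℂ) (p Y : Fin 4 → ℂ) :
    twForm ((lineMat M).mulVec ((joinMat (M.mulVec p)).mulVec (M.mulVec Y))) =
      M.det ^ 3 * twForm ((joinMat p).mulVec Y) := by
  rw [Matrix.mulVec_mulVec Y (joinMat (M.mulVec p)) M, joinMat_mulVec_mul,
    ← Matrix.mulVec_mulVec, Matrix.mulVec_mulVec, lineMat_mul_wedgeTwo, Matrix.smul_mulVec,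
    Matrix.one_mulVec, twForm_smul]

/-- The standard twisted cubic. -/
def twCurve (u : ℂ) : Fin 4 → ℂ := ![1, u, u ^ 2, u ^ 3]

theorem twForm_joinMat_twCurve (p : Fin 4 → ℂ) (u : ℂ) :
    twForm ((joinMat p).mulVec (twCurve u)) = 0 := by
  rw [joinMat_mulVec]
  simp [twForm, twCurve]
  ring

/-- The vertex lies on the chord joining the curve points at `u = 0` and `u = ∞`, so the cone is
nodal there. -/
theorem twForm_joinMat_nodal (Z : Fin 4 → ℂ) : twForm ((joinMat ![1, 0, 0, 1]).mulVec Z) =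
    Z 1 ^ 3 - Z 2 ^ 3 - Z 0 * Z 1 * Z 2 + Z 1 * Z 2 * Z 3 := by
  rw [joinMat_mulVec]
  simp [twForm]
  ring

/-- Here the chord joins the curve points whose parameters are the roots of `u ^ 2 - u + 1`. -/
theorem twForm_joinMat_nodal' (Z : Fin 4 → ℂ) : twForm ((joinMat ![0, 1, 1, 0]).mulVec Z) =
    -(Z 1 - Z 2) ^ 3 - 3 * Z 0 * Z 3 * (Z 1 - Z 2) + Z 0 ^ 2 * Z 3 - Z 0 * Z 3 ^ 2 := by
  rw [joinMat_mulVec]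
  simp [twForm]
  ring

theorem hasDerivAt_line_iff {a b c : ℂ} {g : ℂ → ℂ} (hg : ∀ s, g s = a * s + b * s ^ 2 + c * s ^ 3)
    (h : HasDerivAt g 0 0) : a = 0 := by
  have h1 : HasDerivAt (fun s : ℂ => a * s + b * s ^ 2 + c * s ^ 3) a 0 := by
    have := (((hasDerivAt_id (0 : ℂ)).const_mul a).fun_add
      ((hasDerivAt_pow 2 (0 : ℂ)).const_mul b)).fun_add ((hasDerivAt_pow 3 (0 : ℂ)).const_mul c)
    simpa using this
  rw [funext hg] at h
  exact h1.unique h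

end TwistedCubics

/-! ### Tangent vectors at a twisted cubic -/

section TwistedCubicTangent

open MvPolynomial

theorem twMat_add_smul (a v : Fin 13 → ℂ) (t : ℂ) : twMat (a + t • v) = twMat a + t • twMat v := by
  ext i j
  fin_cases i <;> fin_cases j <;> (simp [twMat]; try ring)

theorem twMat_smul (t : ℂ) (v : Fin 13 → ℂ) : twMat (t • v) = t • twMat v := by
  ext i j
  fin_cases i <;> fin_cases j <;> simp [twMat]

theorem eq_zero_of_twMat_eq_zero {v : Fin 13 → ℂ} (h : twMat v = 0) : v = 0 := by
  have h' : ∀ i j, twMat v i j = 0 := fun i j => by rw [h]; rfl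
  ext k
  fin_cases k
  · exact h' 0 1
  · exact h' 0 2
  · exact h' 0 3
  · exact h' 1 2
  · exact h' 1 3
  · exact h' 2 0
  · exact h' 2 1
  · exact h' 2 2
  · exact h' 2 3
  · exact h' 3 0
  · exact h' 3 1
  · exact h' 3 2
  · exact h' 3 3

theorem differentiable_lineMat {M M' : Matrix (Fin 4) (Fin 4) ℂ} (i j : Fin 6) :
    Differentiable ℂ fun t : ℂ => lineMat (M + t • M') i j := by
  simp only [lineMat_apply, Matrix.of_apply, wedgeTwo, Matrix.transpose_apply, Matrix.add_apply,
    Matrix.smul_apply, smul_eq_mul]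
  fun_prop

/-- If a deformation `M + t • M'` of an invertible matrix changes the Chow form of the projection
from `M p` of the image of the standard twisted cubic only by a factor, to first order, then the
vector field `M⁻¹ M'` along the standard twisted cubic is tangent to its projection from `p`. -/
theorem hasDerivAt_twForm_joinMat {M M' N : Matrix (Fin 4) (Fin 4) ℂ} (hM : M.det ≠ 0)
    (hN : M * N = M') {p : Fin 4 → ℂ} {b : ℂ}
    (H : ∀ X : Fin 4 → ℂ, HasDerivAt
      (fun t : ℂ => twForm ((lineMat (M + t • M')).mulVec ((joinMat (M.mulVec p)).mulVec X)))
      (b * twForm ((lineMat M).mulVec ((joinMat (M.mulVec p)).mulVec X))) 0) (u : ℂ) :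
    HasDerivAt (fun s : ℂ => twForm ((joinMat p).mulVec (twCurve u + s • N.mulVec (twCurve u)))) 0 0 := by
  set c := M.mulVec p
  set X := M.mulVec (twCurve u)
  set Y := M'.mulVec (twCurve u)
  -- The first variable deforms the curve, the second moves the point. The derivative along `(1, 0)`
  -- vanishes by `H`, as `X` lies on the curve; along `(1, 1)` it vanishes since the point follows
  -- the curve. The difference is the claim.
  let Ψ : ℂ × ℂ → ℂ := fun q =>
    twForm ((lineMat (M + q.1 • M')).mulVec ((joinMat c).mulVec (X + q.2 • Y)))
  have hΨ : Differentiable ℂ Ψ := by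
    have h1 : ∀ i, Differentiable ℂ fun q : ℂ × ℂ =>
        (lineMat (M + q.1 • M')).mulVec ((joinMat c).mulVec (X + q.2 • Y)) i := by
      intro i
      have h2 : ∀ j, Differentiable ℂ fun q : ℂ × ℂ => lineMat (M + q.1 • M') i j := fun j =>
        (differentiable_lineMat i j).comp differentiable_fst
      simp only [Matrix.mulVec, dotProduct, Pi.add_apply, Pi.smul_apply, smul_eq_mul]
      fun_prop
    simp only [Ψ, twForm]
    fun_prop
  have hF := (hΨ (0, 0)).hasFDerivAt
  set L := fderiv ℂ Ψ (0, 0)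
  have hline : ∀ x y : ℂ, HasDerivAt (fun t : ℂ => Ψ (t * x, t * y)) (L (x, y)) 0 := by
    intro x y
    have h1 : HasDerivAt (fun t : ℂ => (t * x, t * y)) (x, y) 0 := by
      simpa using ((hasDerivAt_id (0 : ℂ)).mul_const x).prodMk ((hasDerivAt_id (0 : ℂ)).mul_const y)
    have h2 : HasFDerivAt Ψ L ((fun t : ℂ => (t * x, t * y)) 0) := by simpa using hF
    exact h2.comp_hasDerivAt (0 : ℂ) h1
  have hX0 : twForm ((lineMat M).mulVec ((joinMat c).mulVec X)) = 0 := by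
    rw [twForm_lineMat, twForm_joinMat_twCurve, mul_zero]
  have e1 : L (1, 0) = 0 := by
    have h1 := H X
    rw [hX0, mul_zero] at h1
    refine (hline 1 0).unique ?_
    simpa [Ψ] using h1
  have e2 : L (1, 1) = 0 := by
    refine (hline 1 1).unique ?_
    -- While the deformed matrix is invertible, the fixed point `c` is the image of some point under
    -- it, so `twForm_lineMat` applies.
    have hdet : ∀ᶠ t : ℂ in nhds 0, (M + t • M').det ≠ 0 := by
      have hc : Continuous fun t : ℂ => (M + t • M').det := by fun_prop
      exact hc.continuousAt.eventually_ne (by simpa using hM)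
    refine (hasDerivAt_const (0 : ℂ) (0 : ℂ)).congr_of_eventuallyEq ?_
    filter_upwards [hdet] with t ht
    have hu : IsUnit (M + t • M').det := isUnit_iff_ne_zero.2 ht
    have h1 : c = (M + t • M').mulVec ((M + t • M')⁻¹.mulVec c) := by
      rw [Matrix.mulVec_mulVec, Matrix.mul_nonsing_inv _ hu, Matrix.one_mulVec]
    have h2 : X + t • Y = (M + t • M').mulVec (twCurve u) := by
      rw [Matrix.add_mulVec, Matrix.smul_mulVec]
    simp only [Ψ, mul_one, h2]
    rw [h1, twForm_lineMat, twForm_joinMat_twCurve, mul_zero]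
  have e3 : L (0, 1) = 0 := by
    have : ((0, 1) : ℂ × ℂ) = (1, 1) - (1, 0) := by simp
    rw [this, map_sub, e1, e2, sub_zero]
  have h1 := hline 0 1
  rw [e3] at h1
  have h2 : ∀ s : ℂ, Ψ (s * 0, s * 1) =
      M.det ^ 3 * twForm ((joinMat p).mulVec (twCurve u + s • N.mulVec (twCurve u))) := by
    intro s
    have hY : M.mulVec (N.mulVec (twCurve u)) = Y := by rw [Matrix.mulVec_mulVec, hN]
    rw [← twForm_lineMat, Matrix.mulVec_add, Matrix.mulVec_smul, hY]
    simp [Ψ, X, c]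
  simp only [h2] at h1
  have h3 := h1.const_mul (M.det ^ 3)⁻¹
  simpa [← mul_assoc, hM] using h3

/-- A Vandermonde argument. The nodes start at 1 because the parameter 0 is excluded for the first
projection. -/
theorem eq_zero_of_forall_natCast_add_one {n : ℕ} {c : Fin n → ℂ}
    (h : ∀ k : ℕ, ∑ i : Fin n, ((k : ℂ) + 1) ^ (i : ℕ) * c i = 0) : c = 0 :=
  Matrix.eq_zero_of_forall_index_sum_pow_mul_eq_zero (f := fun k : Fin n => ((k : ℕ) : ℂ) + 1)
    (fun k l hkl => Fin.ext (by simpa using hkl)) fun k => h k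

/-- A vector field that is tangent to the projections of the standard twisted cubic from two general
points is tangent to the twisted cubic. -/
theorem tangent_of_projections {N : Matrix (Fin 4) (Fin 4) ℂ}
    (h1 : ∀ u, HasDerivAt (fun s : ℂ => twForm ((joinMat ![1, 0, 0, 1]).mulVec
      (twCurve u + s • N.mulVec (twCurve u)))) 0 0)
    (h2 : ∀ u, HasDerivAt (fun s : ℂ => twForm ((joinMat ![0, 1, 1, 0]).mulVec
      (twCurve u + s • N.mulVec (twCurve u)))) 0 0) :
    N 2 0 = 0 ∧ N 3 0 = 0 ∧ N 3 1 = 0 ∧ N 0 2 = 0 ∧ N 0 3 = 0 ∧ N 1 3 = 0 ∧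
      N 2 1 = 2 * N 1 0 ∧ N 3 2 = 3 * N 1 0 ∧ N 1 2 = 2 * N 2 3 ∧ N 0 1 = 3 * N 2 3 ∧
      N 0 0 + N 2 2 = 2 * N 1 1 ∧ N 1 1 + N 3 3 = 2 * N 2 2 := by
  have hW : ∀ u i, N.mulVec (twCurve u) i = N i 0 + N i 1 * u + N i 2 * u ^ 2 + N i 3 * u ^ 3 := by
    intro u i
    simp [Matrix.mulVec, dotProduct, Fin.sum_univ_four, twCurve]
  -- The differential of the cone vanishes at its node, so its value along the curve carries the
  -- factor `u`, which is cancelled.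
  have E1 : ∀ u : ℂ, u ≠ 0 → -u ^ 2 * N.mulVec (twCurve u) 0 +
      (2 * u + u ^ 4) * N.mulVec (twCurve u) 1 - (2 * u ^ 3 + 1) * N.mulVec (twCurve u) 2 +
      u ^ 2 * N.mulVec (twCurve u) 3 = 0 := by
    intro u hu
    have h := h1 u
    simp only [twForm_joinMat_nodal, Pi.add_apply, Pi.smul_apply, smul_eq_mul] at h
    generalize N.mulVec (twCurve u) = W at h ⊢
    simp only [twCurve] at h
    refine (mul_eq_zero.1 (hasDerivAt_line_iff (a := u * (-u ^ 2 * W 0 +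
      (2 * u + u ^ 4) * W 1 - (2 * u ^ 3 + 1) * W 2 + u ^ 2 * W 3))
      (b := 3 * u * W 1 ^ 2 - 3 * u ^ 2 * W 2 ^ 2 - (W 0 * W 1 * u ^ 2 + W 0 * u * W 2 + W 1 * W 2)
        + (u * W 2 * W 3 + W 1 * u ^ 2 * W 3 + W 1 * W 2 * u ^ 3))
      (c := W 1 ^ 3 - W 2 ^ 3 - W 0 * W 1 * W 2 + W 1 * W 2 * W 3) (fun s => ?_) h)).resolve_left hu
    simp
    ring
  -- Again the factor that vanishes at the node is cancelled.
  have E2 : ∀ u : ℂ, u ^ 2 - u + 1 ≠ 0 → (2 * u ^ 3 - u ^ 4) * N.mulVec (twCurve u) 0 -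
      3 * u ^ 2 * N.mulVec (twCurve u) 1 + 3 * u ^ 2 * N.mulVec (twCurve u) 2 +
      (1 - 2 * u) * N.mulVec (twCurve u) 3 = 0 := by
    intro u hu
    have h := h2 u
    simp only [twForm_joinMat_nodal', Pi.add_apply, Pi.smul_apply, smul_eq_mul] at h
    generalize N.mulVec (twCurve u) = W at h ⊢
    simp only [twCurve] at h
    refine (mul_eq_zero.1 (hasDerivAt_line_iff (a := (u ^ 2 - u + 1) * ((2 * u ^ 3 - u ^ 4) * W 0 -
      3 * u ^ 2 * W 1 + 3 * u ^ 2 * W 2 + (1 - 2 * u) * W 3))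
      (b := -3 * (u - u ^ 2) * (W 1 - W 2) ^ 2 - 3 * (W 0 * W 3 * (u - u ^ 2) +
        W 0 * u ^ 3 * (W 1 - W 2) + W 3 * (W 1 - W 2)) + W 0 ^ 2 * u ^ 3 + 2 * W 0 * W 3
        - W 3 ^ 2 - 2 * W 0 * u ^ 3 * W 3)
      (c := -(W 1 - W 2) ^ 3 - 3 * W 0 * W 3 * (W 1 - W 2) + W 0 ^ 2 * W 3 - W 0 * W 3 ^ 2)
      (fun s => ?_) h)).resolve_left hu
    simp
    ring
  -- The coefficients of `E1` as a polynomial of degree 7 in `u`.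
  have F1 := eq_zero_of_forall_natCast_add_one (c := ![-N 2 0, 2 * N 1 0 - N 2 1,
    -N 0 0 + 2 * N 1 1 - N 2 2 + N 3 0, -N 0 1 + 2 * N 1 2 - N 2 3 - 2 * N 2 0 + N 3 1,
    -N 0 2 + 2 * N 1 3 + N 1 0 - 2 * N 2 1 + N 3 2, -N 0 3 + N 1 1 - 2 * N 2 2 + N 3 3,
    N 1 2 - 2 * N 2 3, N 1 3]) fun k => by
    have h := E1 (k + 1) (by exact_mod_cast k.succ_ne_zero)
    simp only [hW] at h
    simp [Fin.sum_univ_succ]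
    linear_combination h
  have F2 := eq_zero_of_forall_natCast_add_one (c := ![N 3 0, N 3 1 - 2 * N 3 0,
    N 3 2 - 2 * N 3 1 - 3 * N 1 0 + 3 * N 2 0,
    N 3 3 - 2 * N 3 2 + 2 * N 0 0 - 3 * N 1 1 + 3 * N 2 1,
    -2 * N 3 3 + 2 * N 0 1 - N 0 0 - 3 * N 1 2 + 3 * N 2 2,
    2 * N 0 2 - N 0 1 - 3 * N 1 3 + 3 * N 2 3, 2 * N 0 3 - N 0 2, -N 0 3]) fun k => by
    have h := E2 (k + 1) (by
      have h0 : ((k ^ 2 + k + 1 : ℕ) : ℂ) ≠ 0 := by exact_mod_cast (k ^ 2 + k).succ_ne_zero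
      push_cast at h0
      convert h0 using 1
      ring)
    simp only [hW] at h
    simp [Fin.sum_univ_succ]
    linear_combination h
  have a0 : -N 2 0 = 0 := congrFun F1 0
  have a1 : 2 * N 1 0 - N 2 1 = 0 := congrFun F1 1
  have a2 : -N 0 0 + 2 * N 1 1 - N 2 2 + N 3 0 = 0 := congrFun F1 2
  have a5 : -N 0 3 + N 1 1 - 2 * N 2 2 + N 3 3 = 0 := congrFun F1 5
  have a6 : N 1 2 - 2 * N 2 3 = 0 := congrFun F1 6
  have a7 : N 1 3 = 0 := congrFun F1 7
  have b0 : N 3 0 = 0 := congrFun F2 0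
  have b1 : N 3 1 - 2 * N 3 0 = 0 := congrFun F2 1
  have b2 : N 3 2 - 2 * N 3 1 - 3 * N 1 0 + 3 * N 2 0 = 0 := congrFun F2 2
  have b5 : 2 * N 0 2 - N 0 1 - 3 * N 1 3 + 3 * N 2 3 = 0 := congrFun F2 5
  have b6 : 2 * N 0 3 - N 0 2 = 0 := congrFun F2 6
  have b7 : -N 0 3 = 0 := congrFun F2 7
  have c31 : N 3 1 = 0 := by linear_combination b1 + 2 * b0
  have c02 : N 0 2 = 0 := by linear_combination -b6 - 2 * b7
  -- What remains is `𝔤𝔩₂` acting on the cubic: `N 1 0` generates translations of `u`, `N 2 3` their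
  -- opposites fixing `u = 0`, and the diagonal is an arithmetic progression.
  refine ⟨by linear_combination -a0, b0, c31, c02, by linear_combination -b7, a7,
    by linear_combination -a1, by linear_combination b2 + 2 * c31 + 3 * a0,
    by linear_combination a6, by linear_combination -b5 + 2 * c02 - 3 * a7,
    by linear_combination -a2 + b0, by linear_combination a5 - b7⟩

end TwistedCubicTangent

/-! ### The twisted cubic multiview variety -/

section TwistedCubicVariety

open MvPolynomial

/-- For two points of `ℙ³` there is an invertible matrix in the chart `m_0 = 1` that maps the points
`(1 : 0 : 0 : 1)` and `(0 : 1 : 1 : 0)` to them. -/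
theorem exists_twMat_mulVec {x y : Fin 4 → ℂ} (hx : x ≠ 0) (hxy : ∀ t : ℂ, y ≠ t • x) :
    ∃ a : Fin 12 → ℂ, (twMat (Fin.cons 1 a)).det ≠ 0 ∧
      (twMat (Fin.cons 1 a)).mulVec ![1, 0, 0, 1] = x ∧
      (twMat (Fin.cons 1 a)).mulVec ![0, 1, 1, 0] = y := by
  -- The outer columns must add up to `x` and the inner ones to `y`. This and the normal form fix
  -- the upper two rows and leave four free entries below.
  let A : ℂ → ℂ → ℂ → ℂ → Fin 12 → ℂ := fun a a' b b' =>
    ![y 0 - 1, x 0, y 1, x 1 + 1, a, a', y 2 - a', x 2 - a, b, b', y 3 - b', x 3 - b]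
  have hA : ∀ a a' b b', twMat (Fin.cons 1 (A a a' b b')) =
      !![0, 1, y 0 - 1, x 0; -1, 0, y 1, x 1 + 1; a, a', y 2 - a', x 2 - a;
        b, b', y 3 - b', x 3 - b] := fun a a' b b' => rfl
  suffices h : ∃ a a' b b', (twMat (Fin.cons 1 (A a a' b b'))).det ≠ 0 by
    obtain ⟨a, a', b, b', h⟩ := h
    refine ⟨A a a' b b', h, ?_, ?_⟩ <;> rw [hA] <;> ext i <;> fin_cases i <;>
      simp [Matrix.mulVec, dotProduct, Fin.sum_univ_four]
  by_contra! h
  -- The coefficients of the determinant in the free entries are, up to sign, the `2 × 2` minors of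
  -- `x` and `y`. If all vanish, `y` is a multiple of `x`.
  have hdet : ∀ a a' b b' : ℂ, (y 2 * x 3 - x 2 * y 3) + a * (y 1 * x 3 - x 1 * y 3) +
      b * (y 2 * x 1 - x 2 * y 1) + a' * (x 0 * y 3 - y 0 * x 3) + b' * (x 2 * y 0 - x 0 * y 2) +
      (a * b' - a' * b) * (y 0 * x 1 - x 0 * y 1) = 0 := by
    intro a a' b b'
    have h1 := h a a' b b'
    rw [hA, det_eq_sum_mul_minors] at h1
    simp at h1
    linear_combination h1
  have e23 := hdet 0 0 0 0
  have e13 := hdet 1 0 0 0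
  have e12 := hdet 0 0 1 0
  have e03 := hdet 0 1 0 0
  have e02 := hdet 0 0 0 1
  have e01 := hdet 1 0 0 1
  simp only [zero_mul, one_mul, mul_zero, add_zero, sub_zero] at e23 e13 e12 e03 e02 e01
  rw [e23, zero_add] at e13 e12 e03 e02 e01
  rw [e13, e02, zero_add, zero_add] at e01
  obtain ⟨k, hk⟩ := Function.ne_iff.1 hx
  simp only [Pi.zero_apply] at hk
  refine hxy (y k / x k) (funext fun j => ?_)
  simp only [Pi.smul_apply, smul_eq_mul]
  field_simp
  fin_cases k <;> fin_cases j <;> grind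

theorem cons_one_add_mul (a v : Fin 12 → ℂ) (t : ℂ) :
    (Fin.cons 1 fun s => a s + t * v s : Fin 13 → ℂ) = Fin.cons 1 a + t • Fin.cons 0 v := by
  ext s
  refine Fin.cases ?_ (fun s => ?_) s <;> simp

/-- The field `M⁻¹ M'` is confined to a four-dimensional space by `tangent_of_projections`, and the
four entries of the upper left block of `M'`, which are zero, kill it. -/
theorem eq_zero_of_twChow_tangent {n : ℕ} (C : Fin n → Camera) {i i' : Fin n} {a v : Fin 12 → ℂ}
    (hdet : (twMat (Fin.cons 1 a)).det ≠ 0)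
    (hi : (twMat (Fin.cons 1 a)).mulVec ![1, 0, 0, 1] = (C i).center)
    (hi' : (twMat (Fin.cons 1 a)).mulVec ![0, 1, 1, 0] = (C i').center) {b b' : ℂ}
    (H : ∀ j, HasDerivAt (fun t : ℂ => chowProj C 3 (twChow (Fin.cons 1 fun s => a s + t * v s)) i j)
      (b * chowProj C 3 (twChow (Fin.cons 1 a)) i j) 0)
    (H' : ∀ j, HasDerivAt
      (fun t : ℂ => chowProj C 3 (twChow (Fin.cons 1 fun s => a s + t * v s)) i' j)
      (b' * chowProj C 3 (twChow (Fin.cons 1 a)) i' j) 0) : v = 0 := by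
  set M := twMat (Fin.cons 1 a) with hM
  set M' := twMat (Fin.cons 0 v) with hM'
  have key : ∀ (k : Fin n) (b : ℂ), (∀ j, HasDerivAt
      (fun t : ℂ => chowProj C 3 (twChow (Fin.cons 1 fun s => a s + t * v s)) k j)
      (b * chowProj C 3 (twChow (Fin.cons 1 a)) k j) 0) → ∀ X : Fin 4 → ℂ, HasDerivAt
      (fun t : ℂ => twForm ((lineMat (M + t • M')).mulVec ((joinMat (C k).center).mulVec X)))
      (b * twForm ((lineMat M).mulVec ((joinMat (C k).center).mulVec X))) 0 := by
    intro k b Hk X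
    have h1 := hasDerivAt_formEval (β := fun t => chowProj C 3 (twChow
      (Fin.cons 1 fun s => a s + t * v s)) k) (c := b) (by simpa using Hk) ((C k).mat.mulVec X)
    simpa [formEval_chowProj_twChow, cons_one_add_mul, twMat_add_smul] using h1
  have hN : M * (M⁻¹ * M') = M' := by
    rw [← mul_assoc, Matrix.mul_nonsing_inv _ (isUnit_iff_ne_zero.2 hdet), one_mul]
  generalize M⁻¹ * M' = N at hN
  have h1 := key i b H
  have h2 := key i' b' H'
  rw [← hi] at h1
  rw [← hi'] at h2
  obtain ⟨n20, n30, n31, n02, n03, n13, n21, n32, n12, n01, n0022, n1133⟩ :=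
    tangent_of_projections (hasDerivAt_twForm_joinMat hdet hN h1)
      (hasDerivAt_twForm_joinMat hdet hN h2)
  have r : ∀ k l, M k 0 * N 0 l + M k 1 * N 1 l + M k 2 * N 2 l + M k 3 * N 3 l = M' k l := by
    intro k l
    rw [← hN, Matrix.mul_apply, Fin.sum_univ_four]
  have m00 : M 0 0 = 0 := rfl
  have m01 : M 0 1 = 1 := rfl
  have m10 : M 1 0 = -1 := rfl
  have m11 : M 1 1 = 0 := rfl
  have m00' : M' 0 0 = 0 := rfl
  have m01' : M' 0 1 = 0 := rfl
  have m10' : M' 1 0 = 0 := neg_zero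
  have m11' : M' 1 1 = 0 := rfl
  -- The upper left block of `M` is `(0, 1; -1, 0)`. Once `N 1 0 = 0`, the first two columns of `N`
  -- live in its first two rows, and the block equations read off their entries.
  have r00 := r 0 0
  have r10 := r 1 0
  have r01 := r 0 1
  have r11 := r 1 1
  rw [m00, m01, m00', n20, n30] at r00
  have n10 : N 1 0 = 0 := by linear_combination r00
  rw [n10, mul_zero] at n21 n32
  rw [m00, m01, m01', n21, n31] at r01
  have n11 : N 1 1 = 0 := by linear_combination r01
  rw [m10, m11, m10', n20, n30] at r10
  have n00 : N 0 0 = 0 := by linear_combination -r10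
  rw [m10, m11, m11', n21, n31] at r11
  have n01' : N 0 1 = 0 := by linear_combination -r11
  have n23 : N 2 3 = 0 := by linear_combination (n01' - n01) / 3
  rw [n23, mul_zero] at n12
  have n22 : N 2 2 = 0 := by linear_combination n0022 - n00 + 2 * n11
  have n33 : N 3 3 = 0 := by linear_combination n1133 - n11 + 2 * n22
  have hN0 : N = 0 := by
    ext k l
    fin_cases k <;> fin_cases l <;> assumption
  have h0 : M' = 0 := by rw [← hN, hN0, mul_zero]
  ext s
  exact congrFun (eq_zero_of_twMat_eq_zero h0) s.succ

theorem chowProj_twChow_ne_zero {n : ℕ} (C : Fin n → Camera) {i : Fin n} {m : Fin 13 → ℂ}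
    (hdet : (twMat m).det ≠ 0) {p Y : Fin 4 → ℂ} (hp : (twMat m).mulVec p = (C i).center)
    (hY : twForm ((joinMat p).mulVec Y) ≠ 0) : chowProj C 3 (twChow m) i ≠ 0 := by
  intro h0
  have h1 := formEval_chowProj_twChow C m i ((twMat m).mulVec Y)
  rw [← hp, twForm_lineMat, h0] at h1
  simp only [formEval, zero_dotProduct] at h1
  exact mul_ne_zero (pow_ne_zero 3 hdet) hY h1.symm

theorem chowProj_twChow_ne_zero_of_nodal {n : ℕ} (C : Fin n → Camera) {i : Fin n} {m : Fin 13 → ℂ}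
    (hdet : (twMat m).det ≠ 0) (hp : (twMat m).mulVec ![1, 0, 0, 1] = (C i).center) :
    chowProj C 3 (twChow m) i ≠ 0 :=
  chowProj_twChow_ne_zero C hdet hp (Y := ![0, 1, 0, 0]) (by rw [twForm_joinMat_nodal]; simp)

theorem chowProj_twChow_ne_zero_of_nodal' {n : ℕ} (C : Fin n → Camera) {i : Fin n} {m : Fin 13 → ℂ}
    (hdet : (twMat m).det ≠ 0) (hp : (twMat m).mulVec ![0, 1, 1, 0] = (C i).center) :
    chowProj C 3 (twChow m) i ≠ 0 :=
  chowProj_twChow_ne_zero C hdet hp (Y := ![0, 1, 0, 0]) (by rw [twForm_joinMat_nodal']; simp)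

theorem exists_forall_ne_smul (x : Fin 4 → ℂ) : ∃ y : Fin 4 → ℂ, ∀ t : ℂ, y ≠ t • x := by
  by_contra! h
  obtain ⟨s, hs⟩ := h (Pi.single 0 1)
  obtain ⟨t, ht⟩ := h (Pi.single 1 1)
  have s0 := congrFun hs 0
  have s1 := congrFun hs 1
  have t1 := congrFun ht 1
  simp at s0 s1 t1
  rcases s1 with h | h <;> simp [h] at s0 t1

/-- Irreducibility needs no second center; an auxiliary independent point takes its place. -/
theorem exists_chowProj_twChow_ne_zero {n : ℕ} (C : Fin n → Camera) (i : Fin n) :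
    ∃ a : Fin 12 → ℂ, chowProj C 3 (twChow (Fin.cons 1 a)) i ≠ 0 := by
  obtain ⟨y, hy⟩ := exists_forall_ne_smul (C i).center
  obtain ⟨a, hdet, hi, -⟩ := exists_twMat_mulVec (C i).center_ne_zero hy
  exact ⟨a, chowProj_twChow_ne_zero_of_nodal C hdet hi⟩

/-- The exponent is 2 for the minors times 3 for the cubic form. -/
theorem twChow_smul (c : ℂ) (m : Fin 13 → ℂ) : twChow (c • m) = c ^ 6 • twChow m := by
  refine eq_of_formEval_eq fun x => ?_
  have hw : wedgeTwo (twMat (c • m)).transpose = c ^ 2 • wedgeTwo (twMat m).transpose := by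
    ext i j
    simp only [wedgeTwo, twMat_smul, Matrix.of_apply, Matrix.transpose_apply, Matrix.smul_apply,
      smul_eq_mul]
    ring
  have h1 : formEval (c ^ 6 • twChow m) x = c ^ 6 * formEval (twChow m) x := by
    simp [formEval, smul_dotProduct]
  rw [h1, twChow, twChow, formEval_transpose_mulVec, formEval_transpose_mulVec, hw, Matrix.mul_smul,
    Matrix.smul_mul, Matrix.smul_mulVec, formEval_smul_right]
  ring

theorem isPolyFun_twMat {σ : Type} {m : (σ → ℂ) → Fin 13 → ℂ} (hm : ∀ k, IsPolyFun fun a => m a k)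
    (i j : Fin 4) : IsPolyFun fun a => twMat (m a) i j := by
  have h0 : IsPolyFun fun _ : σ → ℂ => (0 : ℂ) := .const 0
  fin_cases i <;> fin_cases j <;> first | exact h0 | exact hm _ | exact (hm _).neg

theorem isPolyFun_chowProj_twChow {σ : Type} {m : (σ → ℂ) → Fin 13 → ℂ}
    (hm : ∀ k, IsPolyFun fun a => m a k) {n : ℕ} (C : Fin n → Camera) (i : Fin n) (j : Mon 2 3) :
    IsPolyFun fun a => chowProj C 3 (twChow (m a)) i j := by
  have hw : ∀ k l, IsPolyFun fun a => wedgeTwo (twMat (m a)).transpose k l := fun k l => by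
    simp only [wedgeTwo, Matrix.of_apply, Matrix.transpose_apply]
    exact ((isPolyFun_twMat hm _ _).mul (isPolyFun_twMat hm _ _)).sub
      ((isPolyFun_twMat hm _ _).mul (isPolyFun_twMat hm _ _))
  have hc : ∀ k l, IsPolyFun fun _ : σ → ℂ => dualMat k l := fun _ _ => .const _
  have hL : ∀ k l, IsPolyFun fun a => (dualMat * wedgeTwo (twMat (m a)).transpose * dualMat) k l :=
    IsPolyFun.matrix_mul (IsPolyFun.matrix_mul hc hw) hc
  refine IsPolyFun.chowProj_apply C (β := fun a => twChow (m a)) (fun k => ?_) i j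
  simp only [twChow]
  refine IsPolyFun.matrix_mulVec (A := fun a => (veroneseMat (h := 5) (N := 5) 3
    (dualMat * wedgeTwo (twMat (m a)).transpose * dualMat)).transpose) (v := fun _ => omegaTw)
    (fun k l => ?_) (fun _ => .const _) k
  simp only [Matrix.transpose_apply]
  exact IsPolyFun.veroneseMat_apply hL _ _

/-- The joint image map of twisted cubics in an affine chart of the parameter space. -/
theorem exists_twParam_polynomials {n : ℕ} (C : Fin n → Camera) :
    ∃ f : Fin n → Mon 2 3 → MvPolynomial (Fin 12) ℂ, ∀ a i j, eval a (f i j) =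
      chowProj C 3 (twChow (Fin.cons 1 a)) i j := by
  have h := isPolyFun_chowProj_twChow (m := fun a : Fin 12 → ℂ => Fin.cons 1 a)
    (fun k => Fin.cases (.const 1) (fun k => .apply k) k) C
  choose f hf using h
  exact ⟨f, fun a i j => hf i j a⟩

theorem exists_twChow_polynomials {n : ℕ} (C : Fin n → Camera) :
    ∃ F : Fin n → Mon 2 3 → MvPolynomial (Fin 13) ℂ, ∀ m i j, eval m (F i j) =
      chowProj C 3 (twChow m) i j := by
  have h := isPolyFun_chowProj_twChow (m := fun a : Fin 13 → ℂ => a) (fun k => .apply k) C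
  choose f hf using h
  exact ⟨f, fun a i j => hf i j a⟩

/-- The twisted cubic multiview variety is the closure of the set parametrised in an affine
chart. -/
theorem twistedCubicMultiviewVariety_eq {n : ℕ} (C : Fin n → Camera)
    {f : Fin n → Mon 2 3 → MvPolynomial (Fin 12) ℂ} (hf : ∀ a i j, eval a (f i j) =
      chowProj C 3 (twChow (Fin.cons 1 a)) i j) :
    twistedCubicMultiviewVariety C = closure (polyImage f) := by
  obtain ⟨F, hF⟩ := exists_twChow_polynomials C
  have hF0 : ∀ i, ∃ j, F i j ≠ 0 := fun i => by
    obtain ⟨a, ha⟩ := exists_chowProj_twChow_ne_zero C i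
    exact exists_coord_ne_zero (hF _ i) ha
  have hF1 : ∀ m i, (fun j => eval m (F i j)) = chowProj C 3 (twChow m) i :=
    fun m i => funext fun j => hF m i j
  rw [twistedCubicMultiviewVariety, closure_eq_closure_polyImage hF0 (X_ne_zero 0),
    ← closure_eq_closure_polyImage hF0 (X_ne_zero 0)]
  · rintro _ ⟨m, hm, hne, rfl⟩
    have hm0 : m 0 ≠ 0 := by simpa using hm
    refine mem_ratImage_of_smul (t := fun k : Fin 12 => m k.succ / m 0) (Set.mem_univ _) hne
      (c := (m 0)⁻¹ ^ 6) (pow_ne_zero _ (inv_ne_zero hm0)) fun i => ?_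
    have h1 : (Fin.cons 1 fun k : Fin 12 => m k.succ / m 0 : Fin 13 → ℂ) = (m 0)⁻¹ • m := by
      ext k
      refine Fin.cases ?_ (fun k => ?_) k
      · simp [hm0]
      · simp [div_eq_inv_mul]
    ext j
    simp only [hf, hF, h1, twChow_smul, chowProj_smul]
  · rintro _ ⟨a, -, hne, rfl⟩
    refine ⟨Fin.cons 1 a, trivial, ?_⟩
    have h1 : ∀ i, (fun j => eval (Fin.cons 1 a) (F i j)) = fun j => eval a (f i j) := fun i => by
      ext j
      rw [hF, hf]
    simp only [h1]
    exact ⟨hne, rfl⟩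
  · rintro _ ⟨m, hm, hne, rfl⟩
    refine ⟨m, fun h => hm (by simp [h]), ?_⟩
    simp only [hF1] at hne ⊢
    exact ⟨hne, rfl⟩
  · rintro _ ⟨m, -, hne, rfl⟩
    refine ⟨m, trivial, ?_⟩
    simp only [hF1]
    exact ⟨hne, rfl⟩

theorem exists_twParam_coord_ne_zero {n : ℕ} (C : Fin n → Camera)
    {f : Fin n → Mon 2 3 → MvPolynomial (Fin 12) ℂ} (hf : ∀ a i j, eval a (f i j) =
      chowProj C 3 (twChow (Fin.cons 1 a)) i j) (i : Fin n) : ∃ j, f i j ≠ 0 := by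
  obtain ⟨a, ha⟩ := exists_chowProj_twChow_ne_zero C i
  exact exists_coord_ne_zero (hf a i) ha

theorem isIrreducible_twistedCubicMultiviewVariety {n : ℕ} (C : Fin n → Camera) :
    IsIrreducible (twistedCubicMultiviewVariety C) := by
  obtain ⟨f, hf⟩ := exists_twParam_polynomials C
  rw [twistedCubicMultiviewVariety_eq C hf]
  exact isIrreducible_closure_polyImage (exists_twParam_coord_ne_zero C hf)

theorem topologicalKrullDim_twistedCubicMultiviewVariety {n : ℕ} (C : Fin n → Camera) {i i' : Fin n}
    (hC : (C i).centerPoint ≠ (C i').centerPoint) :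
    topologicalKrullDim (twistedCubicMultiviewVariety C) = 12 := by
  obtain ⟨f, hf⟩ := exists_twParam_polynomials C
  obtain ⟨a, hdet, hi, hi'⟩ := exists_twMat_mulVec (C i).center_ne_zero
    fun t (ht : (C i').center = t • (C i).center) => hC (centerPoint_eq_of_smul ht).symm
  have hne : ∀ k, chowProj C 3 (twChow (Fin.cons 1 a)) k ≠ 0 → ∃ j, eval a (f k j) ≠ 0 := by
    intro k hk
    obtain ⟨j, hj⟩ := Function.ne_iff.1 hk
    exact ⟨j, by rwa [hf]⟩
  rw [twistedCubicMultiviewVariety_eq C hf, topologicalKrullDim_closure_polyImage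
    (exists_twParam_coord_ne_zero C hf) ![i, i'] a (fun b => ?_) fun v c H => ?_]
  · simp
  · fin_cases b
    · exact hne i (chowProj_twChow_ne_zero_of_nodal C hdet hi)
    · exact hne i' (chowProj_twChow_ne_zero_of_nodal' C hdet hi')
  · simp only [hf] at H
    exact eq_zero_of_twChow_tangent C hdet hi hi' (H 0) (H 1)

end TwistedCubicVariety

end MultiviewCurves

theorem proposition2p1 (n d : ℕ) (hd : 2 ≤ d) (C : Fin n → MultiviewCurves.Camera) :
    IsIrreducible (MultiviewCurves.planeCurveMultiviewVariety C d) ∧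
    IsIrreducible (MultiviewCurves.twistedCubicMultiviewVariety C) ∧
    ((∃ i j, (C i).centerPoint ≠ (C j).centerPoint) →
      (∃ k : ℕ, (k : ℚ) = 1 / 2 * (d : ℚ) ^ 2 + 3 / 2 * (d : ℚ) + 3 ∧
        topologicalKrullDim ↥(MultiviewCurves.planeCurveMultiviewVariety C d) = k) ∧
      topologicalKrullDim ↥(MultiviewCurves.twistedCubicMultiviewVariety C) = 12) := by
  refine ⟨MultiviewCurves.isIrreducible_planeCurveMultiviewVariety (by omega) C,
    MultiviewCurves.isIrreducible_twistedCubicMultiviewVariety C, ?_⟩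
  rintro ⟨i, j, hij⟩
  -- Three parameters for the plane and `(d + 2).choose 2 - 1` for the normalised curve.
  refine ⟨⟨(d + 2).choose 2 + 2, ?_,
    MultiviewCurves.topologicalKrullDim_planeCurveMultiviewVariety hd C hij⟩,
    MultiviewCurves.topologicalKrullDim_twistedCubicMultiviewVariety C hij⟩
  push_cast [Nat.cast_choose_two]
  ring
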